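/- **Theorem (Generalised Steenrod Approximation Theorem).** Conventions. Let $X,Y$ be real locally convex topological vector spaces and let $s\subseteq X$ be open or, more generally, contained in the closure of its interior. A map $f\colon s\to Y$ is called *smooth* if it is continuous, if on the interior of $s$ all iterated differentials, defined recursively by $d^0f=f$ and $$d^{n}f(x).(v_1,\dots,v_n)=\lim_{h\to 0}\tfrac1h\bigl(d^{n-1}f(x+hv_n).(v_1,\dots,v_{n-1})-d^{n-1}f(x).(v_1,\dots,v_{n-1})\bigr),$$ exist and are continuous in $(x,v_1,\dots,v_n)$, and if each $d^nf$ extends continuously to $s\times X^n$. A *locally convex manifold* modelled on $Y$ is a Hausdorff space with an atlas of charts onto open subsets of $Y$ whose coordinate changes are smooth. A *$d$-dimensional manifold with corners* is a paracompact Hausdorff space with an atlas of charts onto relatively open subsets of $\mathbb R^d_+=\{x\in\mathbb R^d: x_i\ge 0 \text{ for all } i\}$ whose coordinate changes are smooth. A map between manifolds is smooth on an open set if it is continuous there and all its local representatives in charts are smooth. Let $M$ be a connected $d$-dimensional manifold with corners, $d\in\mathbb N_0$, let $N$ be a locally convex manifold modelled on a locally convex space $Y$, and let $\pi\colon E\to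 M$ be a locally trivial smooth bundle with typical fibre $N$. That is, $E$ is a Hausdorff space with an atlas of charts onto relatively open subsets of $\mathbb R^d_+\times Y$ whose coordinate changes are smooth, and each point of $M$ has an open neighbourhood $S$ for which there is a diffeomorphism $\varphi\colon \pi^{-1}(S)\to S\times N$ with $\operatorname{pr}_1\circ\varphi=\pi|_{\pi^{-1}(S)}$. Let $\sigma\colon M\to E$ be a continuous section of $\pi$, let $L\subseteq M$ be closed and $U\subseteq M$ be open, and suppose that $\sigma$ is smooth on an open neighbourhood of $L\setminus U$. Then for each open set $O\subseteq E$ with $\sigma(M)\subseteq O$ there exists a continuous section $\tau\colon M\to E$ of $\pi$ with $\tau(M)\subseteq O$ which is smooth on an open neighbourhood of $L$ and satisfies $\tau(x)=\sigma(x)$ for all $x\in M\setminus U$. Moreover, there exists a continuous map $F\colon[0,1]\times M\to O$ with $F(0,\cdot)=\sigma$ and $F(1,\cdot)=\tau$ such that $F(t,\cdot)$ is a section of $\pi$ for each $t\in[0,1]$, and $F(t,x)=\sigma(x)=\tau(x)$ for all $(t,x)\in[0,1]\times(M\setminus U)$. -/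

import Mathlib

open Set Topology
open scoped Manifold ContDiff

/-- Smoothness (in the sense of Michal--Bastiani, i.e. Keller's `C^∞_c`) of a map `f` on a subset
`s` of a locally convex space `X` with values in a locally convex space `Y`; the set `s` is open or,
more generally, contained in the closure of its interior.

The map `D n` is the `n`-th iterated differential `(x, (v₁, …, vₙ)) ↦ dⁿf(x).(v₁, …, vₙ)`.
On the interior of `s` it is obtained recursively from the differential quotients of `D (n - 1)`,
starting from `D 0 = f`; each `D n` is jointly continuous in the point and the directions on all of
`s × Xⁿ`.  So on an open set the iterated differentials of all orders exist and are continuous, and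
in general `f` is continuous, smooth on the interior, and its iterated differentials extend
continuously to the boundary points that belong to `s`.  Values outside `s` play no role. -/
def LCSmoothOn {X Y : Type*} [AddCommGroup X] [Module ℝ X] [TopologicalSpace X]
    [AddCommGroup Y] [Module ℝ Y] [TopologicalSpace Y] (s : Set X) (f : X → Y) : Prop :=
  ∃ D : (n : ℕ) → X → (Fin n → X) → Y,
    (∀ x ∈ s, ∀ v : Fin 0 → X, D 0 x v = f x) ∧
    (∀ n : ℕ, ContinuousOn (fun p : X × (Fin n → X) => D n p.1 p.2) (s ×ˢ univ)) ∧
    (∀ n : ℕ, ∀ x ∈ interior s, ∀ v : Fin (n + 1) → X,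
      Filter.Tendsto
        (fun h : ℝ => h⁻¹ • (D n (x + h • v (Fin.last n)) (Fin.init v) - D n x (Fin.init v)))
        (𝓝[≠] 0) (𝓝 (D (n + 1) x v)))

/-- Smoothness of a map `f : M → M'` on an open subset `W` of `M`, where `M` and `M'` are
manifolds modelled on `H` and `H'`.  The maps `ι : H → X` and `ι' : H' → X'` are the inclusions
of the model spaces into the ambient locally convex spaces (the identity of a locally convex space,
the inclusion of the quadrant into `ℝᵈ`, or a product of these).

The map `f` is smooth on `W` if it is continuous there and if all its local representatives
`ι' ∘ e' ∘ f ∘ e⁻¹ ∘ ι⁻¹`, for charts `e` of `M` and `e'` of `M'`, are smooth on the part of `X`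
where they are defined; `g` is any map on `X` that agrees with the local representative there. -/
def LCManifoldSmoothOn {H X M H' X' M' : Type*}
    [TopologicalSpace H] [AddCommGroup X] [Module ℝ X] [TopologicalSpace X] (ι : H → X)
    [TopologicalSpace M] [ChartedSpace H M]
    [TopologicalSpace H'] [AddCommGroup X'] [Module ℝ X'] [TopologicalSpace X'] (ι' : H' → X')
    [TopologicalSpace M'] [ChartedSpace H' M'] (f : M → M') (W : Set M) : Prop :=
  ContinuousOn f W ∧
    ∀ e ∈ atlas H M, ∀ e' ∈ atlas H' M', ∃ g : X → X',
      LCSmoothOn ((fun p => ι (e p)) '' (W ∩ e.source ∩ f ⁻¹' e'.source)) g ∧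
      ∀ p ∈ W ∩ e.source ∩ f ⁻¹' e'.source, g (ι (e p)) = ι' (e' (f p))

/-- `M` is a smooth manifold with model space `H` (included by `ι` into a locally convex space):
all coordinate changes between charts of the atlas are smooth, that is, the identity map is smooth
in all pairs of charts. -/
def IsLCManifold {H X : Type*} [TopologicalSpace H] [AddCommGroup X] [Module ℝ X]
    [TopologicalSpace X] (ι : H → X) (M : Type*) [TopologicalSpace M] [ChartedSpace H M] : Prop :=
  LCManifoldSmoothOn ι ι (id : M → M) univ

/-- The inclusion of the model quadrant `ℝᵈ₊ = {x | ∀ i, 0 ≤ x i}` into `ℝᵈ`. -/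
def quadrantIncl (d : ℕ) : EuclideanQuadrant d → EuclideanSpace ℝ (Fin d) := fun x => x.1

/-- The inclusion of `ℝᵈ₊ × Y` into `ℝᵈ × Y`. -/
def quadrantProdIncl (d : ℕ) (Y : Type*) :
    ModelProd (EuclideanQuadrant d) Y → EuclideanSpace ℝ (Fin d) × Y :=
  fun p => (p.1.1, p.2)

/-- `π : E → M` is a locally trivial smooth bundle with typical fibre `N`, where `M` is a
`d`-dimensional manifold with corners, `N` is a manifold modelled on the locally convex space `Y`
and `E` is a manifold with corners modelled on `ℝᵈ₊ × Y`: every point of `M` has an open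
neighbourhood `S` with a local trivialisation `φ : π⁻¹(S) → S × N` over `S` that is a
diffeomorphism.  (A `Trivialization` is a homeomorphism that is compatible with the projections.) -/
def IsLocallyTrivialSmoothBundle {M E : Type*} (d : ℕ) (Y : Type*)
    [AddCommGroup Y] [Module ℝ Y] [TopologicalSpace Y]
    [TopologicalSpace M] [ChartedSpace (EuclideanQuadrant d) M]
    (N : Type*) [TopologicalSpace N] [ChartedSpace Y N]
    [TopologicalSpace E] [ChartedSpace (ModelProd (EuclideanQuadrant d) Y) E]
    (π : E → M) : Prop :=
  ∀ x : M, ∃ φ : Bundle.Trivialization N π, x ∈ φ.baseSet ∧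
    LCManifoldSmoothOn (quadrantProdIncl d Y) (quadrantProdIncl d Y) (φ : E → M × N) φ.source ∧
    LCManifoldSmoothOn (quadrantProdIncl d Y) (quadrantProdIncl d Y)
      (φ.toOpenPartialHomeomorph.symm : M × N → E) φ.target

/-!
The total space is only locally a product with a locally convex space, so `σ` is smoothed one chart
at a time, and the modifications are made along a locally finite family of compact sets.

*One chart.*  Over a compact set `C` contained in the domain of a chart of `M` and of a local
trivialisation, and over which the sections in question take values in a chart of the fibre, a
section is a map `f` into `Y`.  A partition of unity `ρᵢ` yields a smooth map `h = ∑ ρᵢ • f xᵢ` near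
`f` (`exists_smooth_approx`); as this is a finite convex combination, `Y` need not be complete.  For
a smooth cut-off function `θ` with support in `C ∩ U` which is `1` near the part of `K ∩ L` where `f`
is not yet smooth, `f + θ • (h - f)` is smooth where `f` was smooth and also near `K ∩ L`, and it
agrees with `f` outside `U`.  In `exists_smoothing_step` this is done with a whole homotopy
`f (t, x)` starting at `σ`, to which `t θ(x) (h x - f (1, x))` is added.  So each step yields the
homotopy along with the section, and no infinite concatenation of homotopies is needed.

*Globalisation.*  A connected paracompact manifold is `σ`-compact, hence covered by a sequence of
compact sets `K n` in the interiors of a locally finite sequence of compact sets `C n` as above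
(`exists_locallyFinite_compact_cover`).  The set `O` is first shrunk so that every section with
values in it stays, over each `C n`, in the chart of the fibre used there.  The set where the
section is smooth increases in each step, and near each point the sequence of homotopies is eventually
constant; its limit is the homotopy sought.

*Calculus.*  Smoothness has to be transported through charts by the chain rule, between subsets of
locally convex spaces that have boundary, and a map might send interior points to boundary points.
Therefore `LCSmoothOn` is compared with a notion that treats all points alike: `CkOn`, iterated
strict directional differentiability (`StrictDirDiffOn`), where the difference quotients
`h⁻¹ • (f (x' + h • v') - f x')` are required to converge as `(x', v', h) → (x, v, 0)` within the
set.  For it the chain rule is immediate.  The two notions agree on relatively open subsets of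
convex sets with dense interior (`LCSmoothOn.cinftyOn`, `CinftyOn.lcSmoothOn`) by the mean value theorem,
which is obtained from the Hahn–Banach theorem (`diffQuot_mem_of_interior`).
-/

/-! ### Strict directional differentiability -/

section Fat

variable {X Y : Type*} [TopologicalSpace X] [TopologicalSpace Y]

/-- The sets on which calculus is done: every point is a limit of interior points. -/
def Fat (s : Set X) : Prop := s ⊆ closure (interior s)

theorem Fat.prod_univ {s : Set X} (hs : Fat s) : Fat (s ×ˢ (univ : Set Y)) := by
  rw [Fat, interior_prod_eq, closure_prod_eq]
  exact prod_mono hs (by simp)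

theorem fat_univ : Fat (univ : Set X) := by simp [Fat]

theorem Fat.inter_isOpen {s W : Set X} (hs : Fat s) (hW : IsOpen W) : Fat (s ∩ W) := by
  rw [Fat, interior_inter, hW.interior_eq]
  exact fun x hx => hW.closure_inter ⟨hs hx.1, hx.2⟩

end Fat

section StrictDirDiff

variable {X Y Z : Type*} [AddCommGroup X] [Module ℝ X] [TopologicalSpace X]
  [AddCommGroup Y] [Module ℝ Y] [TopologicalSpace Y]
  [AddCommGroup Z] [Module ℝ Z] [TopologicalSpace Z]

/-- The difference quotient `h⁻¹ • (f (x + h • v) - f x)` at `p = (x, v, h)`. -/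
noncomputable def diffQuot (f : X → Y) (p : X × X × ℝ) : Y :=
  p.2.2⁻¹ • (f (p.1 + p.2.2 • p.2.1) - f p.1)

/-- The triples `(x, v, h)` with `h ≠ 0` for which the difference quotient of a map on `s` makes
sense, that is, `x` and `x + h • v` belong to `s`. -/
def diffQuotDomain (s : Set X) : Set (X × X × ℝ) :=
  {p | p.1 ∈ s ∧ p.1 + p.2.2 • p.2.1 ∈ s ∧ p.2.2 ≠ 0}

/-- `f'` is the strict directional derivative of `f` on `s`: the difference quotients at
`(x', v', h)` converge to `f' (x, v)` when `(x', v', h)` tends to `(x, v, 0)` within the triples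
for which they make sense.  As the base point varies too, this is meaningful at boundary points of
`s`, and the chain rule holds without any assumption on how maps meet the boundary. -/
def StrictDirDiffOn (s : Set X) (f : X → Y) (f' : X × X → Y) : Prop :=
  ∀ x ∈ s, ∀ v, Filter.Tendsto (diffQuot f) (𝓝[diffQuotDomain s] (x, v, 0)) (𝓝 (f' (x, v)))

/-- The strict directional derivative of `f` on `s`, as the limit of difference quotients (a junk
value if this limit does not exist). -/
noncomputable def dirDeriv (s : Set X) (f : X → Y) (p : X × X) : Y :=
  Filter.limUnder (𝓝[diffQuotDomain s] (p.1, p.2, 0)) (diffQuot f)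

theorem dirDeriv_congr {s : Set X} {f g : X → Y} (h : EqOn f g s) :
    dirDeriv s f = dirDeriv s g := by
  funext p
  have : diffQuot f =ᶠ[𝓝[diffQuotDomain s] (p.1, p.2, 0)] diffQuot g := by
    filter_upwards [self_mem_nhdsWithin] with q hq
    simp only [diffQuot, h hq.1, h hq.2.1]
  simp only [dirDeriv, Filter.limUnder, Filter.map_congr this]

theorem StrictDirDiffOn.congr {s : Set X} {f g : X → Y} {f' : X × X → Y}
    (hf : StrictDirDiffOn s f f') (h : EqOn f g s) : StrictDirDiffOn s g f' := by
  intro x hx v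
  refine (hf x hx v).congr' ?_
  filter_upwards [self_mem_nhdsWithin] with q hq
  simp only [diffQuot, h hq.1, h hq.2.1]

theorem StrictDirDiffOn.congr_deriv {s : Set X} {f : X → Y} {f' g' : X × X → Y}
    (hf : StrictDirDiffOn s f f') (h : EqOn f' g' (s ×ˢ univ)) : StrictDirDiffOn s f g' := by
  intro x hx v
  rw [← h (show (x, v) ∈ s ×ˢ univ from ⟨hx, mem_univ _⟩)]
  exact hf x hx v

section

variable [ContinuousAdd X] [ContinuousSMul ℝ X]

theorem tendsto_add_smul_nhds (x v : X) :
    Filter.Tendsto (fun p : X × X × ℝ => p.1 + p.2.2 • p.2.1) (𝓝 (x, v, 0)) (𝓝 x) := by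
  have : Continuous (fun p : X × X × ℝ => p.1 + p.2.2 • p.2.1) := by fun_prop
  simpa using this.tendsto (x, v, 0)

theorem nhdsWithin_diffQuotDomain_inter {s W : Set X} (hW : IsOpen W) {x : X} (hx : x ∈ W) (v : X) :
    𝓝[diffQuotDomain (s ∩ W)] (x, v, (0 : ℝ)) = 𝓝[diffQuotDomain s] (x, v, 0) := by
  have h1 : ∀ᶠ p : X × X × ℝ in 𝓝 (x, v, 0), p.1 ∈ W :=
    (continuous_fst.tendsto _).eventually (hW.mem_nhds hx)
  have h2 := (tendsto_add_smul_nhds x v).eventually (hW.mem_nhds hx)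
  refine nhdsWithin_eq_iff_eventuallyEq.2 ?_
  filter_upwards [h1, h2] with p hp1 hp2
  simp only [diffQuotDomain, eq_iff_iff]
  exact ⟨fun h => ⟨h.1.1, h.2.1.1, h.2.2⟩, fun h => ⟨⟨h.1, hp1⟩, ⟨h.2.1, hp2⟩, h.2.2⟩⟩

/-- On a fat set the limits of difference quotients are taken along a proper filter. -/
theorem nhdsWithin_diffQuotDomain_neBot {s : Set X} (hs : Fat s) {x : X} (hx : x ∈ s) (v : X) :
    (𝓝[diffQuotDomain s] (x, v, (0 : ℝ))).NeBot := by
  rw [← mem_closure_iff_nhdsWithin_neBot]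
  have hc : Continuous fun y : X => (y, v, (0 : ℝ)) := by fun_prop
  rw [← closure_closure]
  refine map_mem_closure (f := fun y : X => (y, v, (0 : ℝ))) hc (hs hx) fun y hy => ?_
  have hl : Filter.Tendsto (fun h : ℝ => (y, v, h)) (𝓝[≠] 0) (𝓝 (y, v, 0)) :=
    ((by fun_prop : Continuous fun h : ℝ => (y, v, h)).tendsto 0).mono_left nhdsWithin_le_nhds
  refine mem_closure_of_tendsto hl ?_
  filter_upwards [((tendsto_add_smul_nhds y v).comp hl).eventually
    (isOpen_interior.mem_nhds hy), self_mem_nhdsWithin] with h h1 h2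
  exact ⟨interior_subset hy, interior_subset h1, h2⟩

theorem StrictDirDiffOn.dirDeriv_eq [T2Space Y] {s : Set X} {f : X → Y} {f' : X × X → Y}
    (hs : Fat s) (hf : StrictDirDiffOn s f f') : EqOn (dirDeriv s f) f' (s ×ˢ univ) := by
  rintro ⟨x, v⟩ ⟨hx, -⟩
  have := nhdsWithin_diffQuotDomain_neBot hs hx v
  exact (hf x hx v).limUnder_eq

theorem StrictDirDiffOn.inter_isOpen {s W : Set X} {f : X → Y} {f' : X × X → Y}
    (hf : StrictDirDiffOn s f f') (hW : IsOpen W) : StrictDirDiffOn (s ∩ W) f f' := by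
  intro x hx v
  rw [nhdsWithin_diffQuotDomain_inter hW hx.2]
  exact hf x hx.1 v

theorem dirDeriv_inter_isOpen {s W : Set X} (f : X → Y) (hW : IsOpen W) :
    EqOn (dirDeriv (s ∩ W) f) (dirDeriv s f) (W ×ˢ univ) := by
  rintro ⟨x, v⟩ ⟨hx, -⟩
  simp only [dirDeriv, nhdsWithin_diffQuotDomain_inter hW hx]

/-- Along a line through an interior point, the strict directional derivative is the usual limit of
difference quotients. -/
theorem StrictDirDiffOn.tendsto_slope {s : Set X} {f : X → Y} {f' : X × X → Y}
    (hf : StrictDirDiffOn s f f') {x : X} (hx : x ∈ interior s) (v : X) :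
    Filter.Tendsto (fun h : ℝ => h⁻¹ • (f (x + h • v) - f x)) (𝓝[≠] 0) (𝓝 (f' (x, v))) := by
  have hl : Filter.Tendsto (fun h : ℝ => (x, v, h)) (𝓝[≠] 0) (𝓝 (x, v, 0)) :=
    ((by fun_prop : Continuous fun h : ℝ => (x, v, h)).tendsto 0).mono_left nhdsWithin_le_nhds
  refine (hf x (interior_subset hx) v).comp (tendsto_nhdsWithin_iff.2 ⟨hl, ?_⟩)
  filter_upwards [((tendsto_add_smul_nhds x v).comp hl).eventually
    (isOpen_interior.mem_nhds hx), self_mem_nhdsWithin] with h h1 h2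
  exact ⟨interior_subset hx, interior_subset h1, h2⟩

end

/-- The chain rule: the difference quotient of `g ∘ f` at `(x, v, h)` is the difference quotient of
`g` at `(f x, diffQuot f (x, v, h), h)`. -/
theorem StrictDirDiffOn.comp {s : Set X} {t : Set Y} {f : X → Y} {f' : X × X → Y} {g : Y → Z}
    {g' : Y × Y → Z} (hg : StrictDirDiffOn t g g') (hf : StrictDirDiffOn s f f')
    (hfc : ContinuousOn f s) (hst : MapsTo f s t) :
    StrictDirDiffOn s (g ∘ f) (fun p => g' (f p.1, f' p)) := by
  intro x hx v
  have key : ∀ p ∈ diffQuotDomain s,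
      f p.1 + p.2.2 • diffQuot f p = f (p.1 + p.2.2 • p.2.1) := fun p hp => by
    rw [diffQuot, smul_inv_smul₀ hp.2.2]; abel
  have h1 : Filter.Tendsto (fun p : X × X × ℝ => (f p.1, diffQuot f p, p.2.2))
      (𝓝[diffQuotDomain s] (x, v, 0)) (𝓝[diffQuotDomain t] (f x, f' (x, v), 0)) := by
    refine tendsto_nhdsWithin_iff.2 ⟨?_, ?_⟩
    · refine Filter.Tendsto.prodMk_nhds ?_ (Filter.Tendsto.prodMk_nhds (hf x hx v) ?_)
      · refine Filter.Tendsto.comp (hfc x hx) (tendsto_nhdsWithin_iff.2 ⟨?_, ?_⟩)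
        · exact (continuous_fst.tendsto _).mono_left nhdsWithin_le_nhds
        · filter_upwards [self_mem_nhdsWithin] with p hp using hp.1
      · exact ((continuous_snd.comp continuous_snd).tendsto (x, v, (0 : ℝ))).mono_left
          nhdsWithin_le_nhds
    · filter_upwards [self_mem_nhdsWithin] with p hp
      exact ⟨hst hp.1, by rw [key p hp]; exact hst hp.2.1, hp.2.2⟩
  refine ((hg (f x) (hst hx) (f' (x, v))).comp h1).congr' ?_
  filter_upwards [self_mem_nhdsWithin] with p hp
  change p.2.2⁻¹ • (g (f p.1 + p.2.2 • diffQuot f p) - g (f p.1)) = _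
  rw [key p hp]
  rfl

theorem strictDirDiffOn_const (s : Set X) (c : Y) :
    StrictDirDiffOn s (fun _ => c) (fun _ => 0) := by
  intro x hx v
  have : diffQuot (fun _ : X => c) = fun _ => 0 := by funext p; simp [diffQuot]
  rw [this]
  exact tendsto_const_nhds

theorem ContinuousLinearMap.strictDirDiffOn (L : X →L[ℝ] Y) (s : Set X) :
    StrictDirDiffOn s L (fun p => L p.2) := by
  intro x hx v
  have h : Filter.Tendsto (fun p : X × X × ℝ => L p.2.1) (𝓝[diffQuotDomain s] (x, v, 0))
      (𝓝 (L v)) :=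
    ((by fun_prop : Continuous fun p : X × X × ℝ => L p.2.1).tendsto (x, v, 0)).mono_left
      nhdsWithin_le_nhds
  refine h.congr' ?_
  filter_upwards [self_mem_nhdsWithin] with p hp
  simp [diffQuot, inv_smul_smul₀ hp.2.2]

theorem StrictDirDiffOn.prodMk {s : Set X} {f : X → Y} {f' : X × X → Y} {g : X → Z}
    {g' : X × X → Z} (hf : StrictDirDiffOn s f f') (hg : StrictDirDiffOn s g g') :
    StrictDirDiffOn s (fun x => (f x, g x)) (fun p => (f' p, g' p)) := fun x hx v =>
  (hf x hx v).prodMk_nhds (hg x hx v)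

theorem StrictDirDiffOn.smul [ContinuousAdd X] [ContinuousSMul ℝ X] [ContinuousAdd Y]
    [ContinuousSMul ℝ Y] {s : Set X} {f : X → Y}
    {f' : X × X → Y} {a : X → ℝ} {a' : X × X → ℝ} (ha : StrictDirDiffOn s a a')
    (hac : ContinuousOn a s) (hf : StrictDirDiffOn s f f') (hfc : ContinuousOn f s) :
    StrictDirDiffOn s (fun x => a x • f x) (fun p => a' p • f p.1 + a p.1 • f' p) := by
  intro x hx v
  have h1 : Filter.Tendsto (fun p : X × X × ℝ => f (p.1 + p.2.2 • p.2.1))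
      (𝓝[diffQuotDomain s] (x, v, 0)) (𝓝 (f x)) := by
    refine Filter.Tendsto.comp (hfc x hx) (tendsto_nhdsWithin_iff.2 ⟨?_, ?_⟩)
    · exact (tendsto_add_smul_nhds x v).mono_left nhdsWithin_le_nhds
    · filter_upwards [self_mem_nhdsWithin] with p hp using hp.2.1
  have h2 : Filter.Tendsto (fun p : X × X × ℝ => a p.1)
      (𝓝[diffQuotDomain s] (x, v, 0)) (𝓝 (a x)) := by
    refine Filter.Tendsto.comp (hac x hx) (tendsto_nhdsWithin_iff.2 ⟨?_, ?_⟩)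
    · exact (continuous_fst.tendsto _).mono_left nhdsWithin_le_nhds
    · filter_upwards [self_mem_nhdsWithin] with p hp using hp.1
  refine (((ha x hx v).smul h1).add (h2.smul (hf x hx v))).congr fun p => ?_
  simp only [diffQuot, smul_sub, sub_smul, smul_assoc, smul_comm (a p.1) (p.2.2⁻¹)]
  abel

end StrictDirDiff

/-! ### Maps of class `Cⁿ` between locally convex spaces -/

section CkOn

universe u v w

/-- `f` is of class `Cⁿ` on `s`: it is continuous and, if `n > 0`, it has a strict directional
derivative which is of class `Cⁿ⁻¹` on the tangent set `s × X`. -/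
def CkOn : ℕ → ∀ {X : Type u} {Y : Type v} [AddCommGroup X] [Module ℝ X] [TopologicalSpace X]
    [AddCommGroup Y] [Module ℝ Y] [TopologicalSpace Y], Set X → (X → Y) → Prop
  | 0, _, _, _, _, _, _, _, _, s, f => ContinuousOn f s
  | n + 1, _, _, _, _, _, _, _, _, s, f =>
    ContinuousOn f s ∧ StrictDirDiffOn s f (dirDeriv s f) ∧ CkOn n (s ×ˢ univ) (dirDeriv s f)

variable {X : Type u} {Y : Type v} {Z : Type w} [AddCommGroup X] [Module ℝ X] [TopologicalSpace X]
  [AddCommGroup Y] [Module ℝ Y] [TopologicalSpace Y]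
  [AddCommGroup Z] [Module ℝ Z] [TopologicalSpace Z]

theorem CkOn.continuousOn {n : ℕ} {s : Set X} {f : X → Y} (h : CkOn n s f) : ContinuousOn f s := by
  cases n with
  | zero => exact h
  | succ n => exact h.1

theorem CkOn.congr {n : ℕ} {s : Set X} {f g : X → Y} (h : CkOn n s f) (hfg : EqOn f g s) :
    CkOn n s g := by
  cases n with
  | zero => exact ContinuousOn.congr h hfg.symm
  | succ n =>
    refine ⟨h.1.congr hfg.symm, ?_, ?_⟩ <;> rw [← dirDeriv_congr hfg]
    · exact h.2.1.congr hfg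
    · exact h.2.2

theorem CkOn.of_succ {n : ℕ} {s : Set X} {f : X → Y} (h : CkOn (n + 1) s f) : CkOn n s f := by
  induction n generalizing X with
  | zero => exact h.1
  | succ n ih => exact ⟨h.1, h.2.1, ih h.2.2⟩

section

variable [IsTopologicalAddGroup X] [ContinuousSMul ℝ X]

theorem CkOn.inter_isOpen {n : ℕ} {s W : Set X} {f : X → Y} (h : CkOn n s f) (hW : IsOpen W) :
    CkOn n (s ∩ W) f := by
  induction n generalizing X with
  | zero => exact ContinuousOn.mono h inter_subset_left
  | succ n ih =>
    have e : EqOn (dirDeriv s f) (dirDeriv (s ∩ W) f) ((s ∩ W) ×ˢ univ) :=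
      (dirDeriv_inter_isOpen f hW).symm.mono (prod_mono inter_subset_right subset_rfl)
    refine ⟨h.1.mono inter_subset_left, (h.2.1.inter_isOpen hW).congr_deriv e, ?_⟩
    refine CkOn.congr ?_ e
    have := ih h.2.2 (hW.prod (isOpen_univ (X := X)))
    rwa [prod_inter_prod, inter_self] at this

theorem CkOn.of_locally {n : ℕ} {s : Set X} {f : X → Y}
    (h : ∀ x ∈ s, ∃ W, IsOpen W ∧ x ∈ W ∧ CkOn n (s ∩ W) f) : CkOn n s f := by
  have hc : ContinuousOn f s := continuousOn_of_locally_continuousOn fun x hx =>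
    let ⟨W, hW, hxW, hf⟩ := h x hx
    ⟨W, hW, hxW, hf.continuousOn⟩
  induction n generalizing X with
  | zero => exact hc
  | succ n ih =>
    have hloc : ∀ p ∈ s ×ˢ (univ : Set X), ∃ W, IsOpen W ∧ p ∈ W ∧
        CkOn n (s ×ˢ univ ∩ W) (dirDeriv s f) := fun p hp => by
      obtain ⟨W, hW, hxW, hf⟩ := h p.1 hp.1
      refine ⟨W ×ˢ univ, hW.prod isOpen_univ, ⟨hxW, mem_univ _⟩, ?_⟩
      rw [prod_inter_prod, inter_self]
      exact hf.2.2.congr ((dirDeriv_inter_isOpen f hW).mono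
        (prod_mono inter_subset_right subset_rfl))
    refine ⟨hc, fun x hx v => ?_, ih hloc ?_⟩
    · obtain ⟨W, hW, hxW, hf⟩ := h x hx
      rw [← nhdsWithin_diffQuotDomain_inter hW hxW,
        ← dirDeriv_inter_isOpen (s := s) f hW (show (x, v) ∈ W ×ˢ univ from ⟨hxW, mem_univ _⟩)]
      exact hf.2.1 x ⟨hx, hxW⟩ v
    · exact continuousOn_of_locally_continuousOn fun x hx =>
        let ⟨W, hW, hxW, hf⟩ := hloc x hx
        ⟨W, hW, hxW, hf.continuousOn⟩

/-- As limits of difference quotients are unique on fat sets, any strict directional derivative may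
be used to verify that a map is of class `Cⁿ⁺¹`. -/
theorem CkOn.intro [T2Space Y] {n : ℕ} {s : Set X} {f : X → Y} {f' : X × X → Y} (hs : Fat s)
    (hc : ContinuousOn f s) (hd : StrictDirDiffOn s f f') (h : CkOn n (s ×ˢ univ) f') :
    CkOn (n + 1) s f :=
  have e := hd.dirDeriv_eq hs
  ⟨hc, hd.congr_deriv e.symm, h.congr e.symm⟩

theorem CkOn.const [T2Space Y] {s : Set X} (hs : Fat s) (n : ℕ) (c : Y) :
    CkOn n s (fun _ : X => c) := by
  induction n generalizing X c with
  | zero => exact continuousOn_const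
  | succ n ih =>
    exact CkOn.intro hs continuousOn_const (strictDirDiffOn_const s c) (ih hs.prod_univ 0)

theorem ContinuousLinearMap.ckOn [T2Space Y] {s : Set X} (hs : Fat s) (n : ℕ) (L : X →L[ℝ] Y) :
    CkOn n s L := by
  induction n generalizing X with
  | zero => exact L.continuous.continuousOn
  | succ n ih =>
    exact CkOn.intro hs L.continuous.continuousOn (L.strictDirDiffOn s)
      (ih hs.prod_univ (L.comp (ContinuousLinearMap.snd ℝ X X)))

theorem CkOn.prodMk [T2Space Y] [T2Space Z] {n : ℕ} {s : Set X} {f : X → Y} {g : X → Z}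
    (hs : Fat s) (hf : CkOn n s f) (hg : CkOn n s g) : CkOn n s (fun x => (f x, g x)) := by
  induction n generalizing X with
  | zero => exact ContinuousOn.prodMk hf hg
  | succ n ih =>
    exact CkOn.intro hs (hf.1.prodMk hg.1) (hf.2.1.prodMk hg.2.1) (ih hs.prod_univ hf.2.2 hg.2.2)

end

/-- For a linear inner map no uniqueness of its derivative is needed, so the middle space need not
be Hausdorff. -/
theorem CkOn.comp_continuousLinearMap [IsTopologicalAddGroup X] [ContinuousSMul ℝ X]
    [T2Space Z] {n : ℕ} {s : Set X} {t : Set Y} {g : Y → Z}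
    (hs : Fat s) (hg : CkOn n t g) (L : X →L[ℝ] Y) (hst : MapsTo L s t) :
    CkOn n s (g ∘ L) := by
  induction n generalizing X Y with
  | zero => exact ContinuousOn.comp hg L.continuous.continuousOn hst
  | succ n ih =>
    refine CkOn.intro hs (hg.1.comp L.continuous.continuousOn hst)
      (hg.2.1.comp (L.strictDirDiffOn s) L.continuous.continuousOn hst) ?_
    exact ih hs.prod_univ hg.2.2 (L.prodMap L) fun p hp => ⟨hst hp.1, mem_univ _⟩

theorem CkOn.comp_fst [IsTopologicalAddGroup X] [ContinuousSMul ℝ X] [T2Space Y]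
    {n : ℕ} {s : Set X} {f : X → Y} (hs : Fat s) (hf : CkOn n s f) :
    CkOn n (s ×ˢ (univ : Set X)) (fun p => f p.1) :=
  hf.comp_continuousLinearMap hs.prod_univ (ContinuousLinearMap.fst ℝ X X) fun _ hp => hp.1

theorem CkOn.comp [IsTopologicalAddGroup X] [ContinuousSMul ℝ X]
    [T2Space Y] [T2Space Z] {n : ℕ} {s : Set X} {t : Set Y} {f : X → Y} {g : Y → Z}
    (hs : Fat s) (hg : CkOn n t g) (hf : CkOn n s f) (hst : MapsTo f s t) :
    CkOn n s (g ∘ f) := by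
  induction n generalizing X Y with
  | zero => exact ContinuousOn.comp hg hf hst
  | succ n ih =>
    refine CkOn.intro hs (hg.1.comp hf.1 hst) (hg.2.1.comp hf.2.1 hf.1 hst) ?_
    exact ih hs.prod_univ hg.2.2 ((hf.of_succ.comp_fst hs).prodMk hs.prod_univ hf.2.2)
      fun p hp => ⟨hst hp.1, mem_univ _⟩

variable [IsTopologicalAddGroup X] [ContinuousSMul ℝ X] [IsTopologicalAddGroup Y]
  [ContinuousSMul ℝ Y] [T2Space Y]

theorem CkOn.add {n : ℕ} {s : Set X} {f g : X → Y} (hs : Fat s) (hf : CkOn n s f)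
    (hg : CkOn n s g) : CkOn n s (fun x => f x + g x) :=
  CkOn.comp hs (t := univ) (ContinuousLinearMap.ckOn fat_univ n
    (ContinuousLinearMap.fst ℝ Y Y + ContinuousLinearMap.snd ℝ Y Y)) (hf.prodMk hs hg)
    (mapsTo_univ _ _)

theorem CkOn.sub {n : ℕ} {s : Set X} {f g : X → Y} (hs : Fat s) (hf : CkOn n s f)
    (hg : CkOn n s g) : CkOn n s (fun x => f x - g x) :=
  CkOn.comp hs (t := univ) (ContinuousLinearMap.ckOn fat_univ n
    (ContinuousLinearMap.fst ℝ Y Y - ContinuousLinearMap.snd ℝ Y Y)) (hf.prodMk hs hg)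
    (mapsTo_univ _ _)

theorem CkOn.sum {ι : Type*} {n : ℕ} {s : Set X} {f : ι → X → Y} (hs : Fat s) (t : Finset ι)
    (hf : ∀ i ∈ t, CkOn n s (f i)) : CkOn n s (fun x => ∑ i ∈ t, f i x) := by
  classical
  induction t using Finset.induction_on with
  | empty => simpa using CkOn.const hs n (0 : Y)
  | insert a t ha ih =>
    simp only [Finset.sum_insert ha]
    exact (hf a (by simp)).add hs (ih fun i hi => hf i (by simp [hi]))

theorem CkOn.smul {n : ℕ} {s : Set X} {a : X → ℝ} {f : X → Y} (hs : Fat s) (ha : CkOn n s a)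
    (hf : CkOn n s f) : CkOn n s (fun x => a x • f x) := by
  induction n generalizing X with
  | zero => exact ContinuousOn.smul ha hf
  | succ n ih =>
    refine CkOn.intro hs (ha.1.smul hf.1) (ha.2.1.smul ha.1 hf.2.1 hf.1) ?_
    exact (ih hs.prod_univ ha.2.2 (hf.of_succ.comp_fst hs)).add hs.prod_univ
      (ih hs.prod_univ (ha.of_succ.comp_fst hs) hf.2.2)

end CkOn

/-! ### The mean value theorem and strict differentiability -/

section MeanValue

variable {X Y : Type*} [AddCommGroup X] [Module ℝ X] [TopologicalSpace X]
  [IsTopologicalAddGroup X] [ContinuousSMul ℝ X]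
  [AddCommGroup Y] [Module ℝ Y] [TopologicalSpace Y]
  [IsTopologicalAddGroup Y] [ContinuousSMul ℝ Y] [LocallyConvexSpace ℝ Y]

theorem exists_isClosed_convex_subset_nhds {y : Y} {U : Set Y} (hU : U ∈ 𝓝 y) :
    ∃ K ∈ 𝓝 y, IsClosed K ∧ Convex ℝ K ∧ K ⊆ U := by
  obtain ⟨C, hC, hCc, hCU⟩ := exists_mem_nhds_isClosed_subset hU
  obtain ⟨V, ⟨hV, hVc⟩, hVC⟩ := (LocallyConvexSpace.convex_basis (𝕜 := ℝ) y).mem_iff.1 hC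
  exact ⟨closure V, Filter.mem_of_superset hV subset_closure, isClosed_closure, hVc.closure,
    (closure_minimal hVC hCc).trans hCU⟩

omit [TopologicalSpace X] [IsTopologicalAddGroup X] [ContinuousSMul ℝ X] in
/-- Mean value theorem in an open convex set: if the derivatives in direction `v` lie in a closed
convex set, so do the difference quotients. -/
theorem diffQuot_mem_of_isOpen {C : Set X} {K : Set Y} {f : X → Y} {f' : X × X → Y}
    (hK : IsClosed K) (hKc : Convex ℝ K) (hC : Convex ℝ C) {x v : X} {h : ℝ}
    (hx : x ∈ C) (hxv : x + h • v ∈ C) (hh : h ≠ 0)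
    (hd : ∀ z ∈ C, Filter.Tendsto (fun k : ℝ => k⁻¹ • (f (z + k • v) - f z)) (𝓝[≠] 0)
      (𝓝 (f' (z, v))))
    (hf' : ∀ z ∈ C, f' (z, v) ∈ K) : diffQuot f (x, v, h) ∈ K := by
  by_contra hn
  obtain ⟨l, u, hlu, hul⟩ := geometric_hahn_banach_closed_point hKc hK hn
  -- the line from `x` to `x + h • v`, and `f` along it, tested against the functional `l`
  let c : ℝ → X := fun t => x + (t * h) • v
  have hc : ∀ t ∈ Icc (0 : ℝ) 1, c t ∈ C := fun t ht => by
    have := hC.add_smul_mem hx hxv ht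
    rwa [smul_smul] at this
  have hder : ∀ t ∈ Icc (0 : ℝ) 1, HasDerivAt (fun t => l (f (c t))) (h * l (f' (c t, v))) t := by
    intro t ht
    have h1 : Filter.Tendsto (fun k : ℝ => k * h) (𝓝[≠] 0) (𝓝[≠] 0) := by
      refine tendsto_nhdsWithin_iff.2 ⟨?_, ?_⟩
      · simpa using ((continuous_id.mul continuous_const).tendsto (0 : ℝ)).mono_left
          (nhdsWithin_le_nhds (s := {0}ᶜ)) (f := fun k : ℝ => k * h)
      · filter_upwards [self_mem_nhdsWithin] with k hk using mul_ne_zero hk hh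
    have h2 := ((l.continuous.tendsto _).comp ((hd (c t) (hc t ht)).comp h1)).const_mul h
    rw [hasDerivAt_iff_tendsto_slope_zero]
    refine h2.congr fun k => ?_
    have e : c t + (k * h) • v = c (t + k) := by simp only [c, add_mul, add_smul, add_assoc]
    simp only [Function.comp, e, map_smul, map_sub, smul_eq_mul, mul_inv]
    field_simp
  obtain ⟨t, ht, he⟩ := exists_hasDerivAt_eq_slope (fun t => l (f (c t)))
    (fun t => h * l (f' (c t, v))) zero_lt_one
    (fun t ht => (hder t ht).continuousAt.continuousWithinAt)
    (fun t ht => hder t (Ioo_subset_Icc_self ht))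
  have h3 : l (diffQuot f (x, v, h)) = l (f' (c t, v)) := by
    simp only [c, one_mul, zero_mul, zero_smul, add_zero, sub_zero, div_one] at he
    simp only [diffQuot, map_smul, map_sub, smul_eq_mul, ← he]
    simp only [c]
    field_simp
  exact absurd (hlu _ (hf' _ (hc t (Ioo_subset_Icc_self ht)))) (by rw [← h3]; exact not_lt.2 hul.le)

/-- Mean value theorem in a convex set with nonempty interior: it suffices to control the
derivatives in the interior. -/
theorem diffQuot_mem_of_interior {C : Set X} {K : Set Y} {f : X → Y} {f' : X × X → Y}
    (hK : IsClosed K) (hKc : Convex ℝ K) (hC : Convex ℝ C) (hCi : (interior C).Nonempty)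
    (hfc : ContinuousOn f C) {x v : X} {h : ℝ}
    (hx : x ∈ C) (hxv : x + h • v ∈ C) (hh : h ≠ 0)
    (hd : ∀ z ∈ interior C, Filter.Tendsto (fun k : ℝ => k⁻¹ • (f (z + k • v) - f z)) (𝓝[≠] 0)
      (𝓝 (f' (z, v))))
    (hf' : ∀ z ∈ interior C, f' (z, v) ∈ K) : diffQuot f (x, v, h) ∈ K := by
  obtain ⟨q, hq⟩ := hCi
  -- push the segment into the interior by a homothety with centre `q`
  let a : ℝ → X := fun ε => x + ε • (q - x)
  let b : ℝ → X := fun ε => (x + h • v) + ε • (q - (x + h • v))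
  have hab : ∀ ε, a ε + ((1 - ε) * h) • v = b ε := fun ε => by
    simp only [a, b]; module
  have ha : ∀ ε ∈ Ioc (0 : ℝ) 1, a ε ∈ interior C := fun ε he =>
    hC.add_smul_sub_mem_interior hx hq he
  have hb : ∀ ε ∈ Ioc (0 : ℝ) 1, b ε ∈ interior C := fun ε he =>
    hC.add_smul_sub_mem_interior hxv hq he
  have hev : ∀ᶠ ε in 𝓝[>] (0 : ℝ), ε ∈ Ioo (0 : ℝ) 1 := Ioo_mem_nhdsGT zero_lt_one
  have hmem : ∀ᶠ ε in 𝓝[>] (0 : ℝ), ((1 - ε) * h)⁻¹ • (f (b ε) - f (a ε)) ∈ K := by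
    filter_upwards [hev] with ε he
    have := diffQuot_mem_of_isOpen (h := (1 - ε) * h) hK hKc hC.interior (ha ε ⟨he.1, he.2.le⟩)
      (by rw [hab]; exact hb ε ⟨he.1, he.2.le⟩)
      (mul_ne_zero (by linarith [he.2]) hh) hd hf'
    simpa only [diffQuot, hab] using this
  have hca : Filter.Tendsto (fun ε => f (a ε)) (𝓝[>] 0) (𝓝 (f x)) := by
    refine (hfc x hx).tendsto.comp (tendsto_nhdsWithin_iff.2 ⟨?_, ?_⟩)
    · have : Continuous a := by fun_prop
      simpa [a] using (this.tendsto 0).mono_left nhdsWithin_le_nhds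
    · filter_upwards [hev] with ε he using interior_subset (ha ε ⟨he.1, he.2.le⟩)
  have hcb : Filter.Tendsto (fun ε => f (b ε)) (𝓝[>] 0) (𝓝 (f (x + h • v))) := by
    refine (hfc _ hxv).tendsto.comp (tendsto_nhdsWithin_iff.2 ⟨?_, ?_⟩)
    · have : Continuous b := by fun_prop
      simpa [b] using (this.tendsto 0).mono_left nhdsWithin_le_nhds
    · filter_upwards [hev] with ε he using interior_subset (hb ε ⟨he.1, he.2.le⟩)
  have hch : Filter.Tendsto (fun ε : ℝ => ((1 - ε) * h)⁻¹) (𝓝[>] 0) (𝓝 h⁻¹) := by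
    have : ContinuousAt (fun ε : ℝ => ((1 - ε) * h)⁻¹) 0 :=
      ContinuousAt.inv₀ (by fun_prop) (by simpa using hh)
    simpa using this.tendsto.mono_left nhdsWithin_le_nhds
  exact hK.mem_of_tendsto (hch.smul (hcb.sub hca)) hmem

/-- A relatively open subset of a convex set with dense interior. -/
def RelOpenInConvex (s : Set X) : Prop :=
  ∃ Q Ω : Set X, Convex ℝ Q ∧ Fat Q ∧ IsOpen Ω ∧ s = Q ∩ Ω

omit [IsTopologicalAddGroup X] [ContinuousSMul ℝ X] in
theorem RelOpenInConvex.fat {s : Set X} (hs : RelOpenInConvex s) : Fat s := by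
  obtain ⟨Q, Ω, -, hQ, hΩ, rfl⟩ := hs
  exact hQ.inter_isOpen hΩ

omit [IsTopologicalAddGroup X] [ContinuousSMul ℝ X] in
theorem RelOpenInConvex.prod_univ {s : Set X} (hs : RelOpenInConvex s) :
    RelOpenInConvex (s ×ˢ (univ : Set X)) := by
  obtain ⟨Q, Ω, hQ, hQf, hΩ, rfl⟩ := hs
  refine ⟨Q ×ˢ univ, Ω ×ˢ univ, hQ.prod convex_univ, hQf.prod_univ, hΩ.prod isOpen_univ, ?_⟩
  rw [prod_inter_prod, inter_self]

/-- On a relatively open subset of a convex set, a directional derivative in the interior with a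
continuous extension to the whole set is a strict directional derivative there. -/
theorem RelOpenInConvex.strictDirDiffOn [LocallyConvexSpace ℝ X] {s : Set X}
    (hs : RelOpenInConvex s) {f : X → Y} {f' : X × X → Y} (hf : ContinuousOn f s)
    (hf' : ContinuousOn f' (s ×ˢ univ))
    (hd : ∀ x ∈ interior s, ∀ v, Filter.Tendsto (fun h : ℝ => h⁻¹ • (f (x + h • v) - f x)) (𝓝[≠] 0)
      (𝓝 (f' (x, v)))) : StrictDirDiffOn s f f' := by
  obtain ⟨Q, Ω, hQ, hQf, hΩ, rfl⟩ := hs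
  intro x hx v U hU
  obtain ⟨K, hK, hKc, hKx, hKU⟩ := exists_isClosed_convex_subset_nhds hU
  have h1 := hf' (x, v) ⟨hx, mem_univ _⟩ hK
  rw [Filter.mem_map, mem_nhdsWithin_iff_exists_mem_nhds_inter] at h1
  obtain ⟨T, hT, hTK⟩ := h1
  obtain ⟨A, hA, V, hV, hAV⟩ := mem_nhds_prod_iff.1 hT
  obtain ⟨W, ⟨hW, hWc⟩, hWA⟩ := (LocallyConvexSpace.convex_basis (𝕜 := ℝ) x).mem_iff.1
    (Filter.inter_mem hA (hΩ.mem_nhds hx.2))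
  have hWA : W ⊆ A ∩ Ω := hWA
  have hCs : Q ∩ W ⊆ Q ∩ Ω := fun z hz => ⟨hz.1, (hWA hz.2).2⟩
  have hne : (interior (Q ∩ W)).Nonempty := by
    rw [interior_inter]
    have := mem_closure_iff_nhds.1 (hQf hx.1) _ (interior_mem_nhds.2 hW)
    rwa [inter_comm] at this
  have e1 : ∀ᶠ p : X × X × ℝ in 𝓝 (x, v, 0), p.1 ∈ W :=
    (continuous_fst.tendsto (x, v, (0 : ℝ))).eventually hW
  have e2 := (tendsto_add_smul_nhds x v).eventually hW
  have e3 : ∀ᶠ p : X × X × ℝ in 𝓝 (x, v, 0), p.2.1 ∈ V :=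
    ((by fun_prop : Continuous fun p : X × X × ℝ => p.2.1).tendsto (x, v, (0 : ℝ))).eventually hV
  have : ∀ᶠ p in 𝓝[diffQuotDomain (Q ∩ Ω)] (x, v, (0 : ℝ)), diffQuot f p ∈ K := by
    filter_upwards [nhdsWithin_le_nhds e1, nhdsWithin_le_nhds e2, nhdsWithin_le_nhds e3,
      self_mem_nhdsWithin] with p h1 h2 h3 h4
    refine diffQuot_mem_of_interior hKc hKx (hQ.inter hWc) hne (hf.mono hCs) ⟨h4.1.1, h1⟩
      ⟨h4.2.1.1, h2⟩ h4.2.2 (fun z hz => hd z (interior_mono hCs hz) _) fun z hz => ?_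
    have hz' := interior_subset hz
    exact hTK ⟨hAV ⟨(hWA hz'.2).1, h3⟩, hCs hz', mem_univ _⟩
  exact Filter.mem_of_superset this fun p hp => hKU hp

end MeanValue

/-! ### Comparison of the notions of smoothness -/

section Comparison

universe u v

/-- `f` is of class `Cⁿ` on `s` for all `n`. -/
def CinftyOn {X : Type u} {Y : Type v} [AddCommGroup X] [Module ℝ X] [TopologicalSpace X]
    [AddCommGroup Y] [Module ℝ Y] [TopologicalSpace Y] (s : Set X) (f : X → Y) : Prop :=
  ∀ n, CkOn n s f

variable {X : Type u} {Y : Type v} [AddCommGroup X] [Module ℝ X] [TopologicalSpace X]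
  [IsTopologicalAddGroup X] [ContinuousSMul ℝ X]
  [AddCommGroup Y] [Module ℝ Y] [TopologicalSpace Y]
  [IsTopologicalAddGroup Y] [ContinuousSMul ℝ Y] [T2Space Y]

/-- The `n`-th iterated differential of `f`, obtained from the previous one by differentiating in
the first variable only. -/
noncomputable def iterDirDeriv (s : Set X) (f : X → Y) : (n : ℕ) → X × (Fin n → X) → Y
  | 0 => fun p => f p.1
  | n + 1 => fun p => dirDeriv (s ×ˢ univ) (iterDirDeriv s f n)
      ((p.1, Fin.init p.2), (p.2 (Fin.last n), 0))

omit [IsTopologicalAddGroup Y] [ContinuousSMul ℝ Y] in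
theorem CinftyOn.iterDirDeriv {s : Set X} {f : X → Y} (hs : Fat s) (hf : CinftyOn s f) (n : ℕ) :
    CinftyOn (s ×ˢ univ) (iterDirDeriv s f n) := by
  induction n with
  | zero =>
    exact fun k => (hf k).comp_continuousLinearMap hs.prod_univ
      (ContinuousLinearMap.fst ℝ X (Fin 0 → X)) fun p hp => hp.1
  | succ n ih =>
    intro k
    have h := (ih (k + 1)).2.2
    let L : X × (Fin (n + 1) → X) →L[ℝ] (X × (Fin n → X)) × (X × (Fin n → X)) :=
      ((ContinuousLinearMap.fst ℝ _ _).prod (ContinuousLinearMap.pi fun i : Fin n =>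
        (ContinuousLinearMap.proj i.castSucc).comp (ContinuousLinearMap.snd ℝ _ _))).prod
      (((ContinuousLinearMap.proj (Fin.last n)).comp (ContinuousLinearMap.snd ℝ _ _)).prod 0)
    exact h.comp_continuousLinearMap hs.prod_univ L fun p hp => ⟨⟨hp.1, mem_univ _⟩, mem_univ _⟩

omit [IsTopologicalAddGroup Y] [ContinuousSMul ℝ Y] in
/-- The maps `iterDirDeriv s f n` are iterated differentials in the sense of `LCSmoothOn`. -/
theorem CinftyOn.lcSmoothOn {s : Set X} {f : X → Y} (hs : Fat s) (hf : CinftyOn s f) :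
    LCSmoothOn s f := by
  refine ⟨fun n x v => _root_.iterDirDeriv s f n (x, v), fun x _ v => rfl,
    fun n => (hf.iterDirDeriv hs n 0).continuousOn, fun n x hx v => ?_⟩
  have h := (hf.iterDirDeriv hs n 1).2.1.tendsto_slope (x := (x, Fin.init v))
    (by rw [interior_prod_eq]; exact ⟨hx, by simp⟩) (v (Fin.last n), 0)
  simpa [_root_.iterDirDeriv] using h

section

theorem tendsto_add_smul_punctured (x v : X) :
    Filter.Tendsto (fun h : ℝ => x + h • v) (𝓝[≠] 0) (𝓝 x) := by
  simpa using ((by fun_prop : Continuous fun h : ℝ => x + h • v).tendsto 0).mono_left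
    nhdsWithin_le_nhds

omit [ContinuousSMul ℝ Y] in
/-- The strict directional derivative is additive in the direction. -/
theorem StrictDirDiffOn.add_direction {s : Set X} {f : X → Y} {f' : X × X → Y}
    (hf : StrictDirDiffOn s f f') {x : X} (hx : x ∈ interior s) (v w : X) :
    f' (x, v + w) = f' (x, v) + f' (x, w) := by
  have h0 : Filter.Tendsto (fun h : ℝ => h) (𝓝[≠] 0) (𝓝 0) := nhdsWithin_le_nhds
  have hl : Filter.Tendsto (fun h : ℝ => (x + h • v, w, h)) (𝓝[≠] 0)
      (𝓝[diffQuotDomain s] (x, w, 0)) := by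
    have h1 := tendsto_add_smul_punctured x v
    have h2 : Filter.Tendsto (fun h : ℝ => x + h • v + h • w) (𝓝[≠] 0) (𝓝 x) := by
      simpa only [smul_add, add_assoc] using tendsto_add_smul_punctured x (v + w)
    refine tendsto_nhdsWithin_iff.2
      ⟨h1.prodMk_nhds (tendsto_const_nhds.prodMk_nhds h0), ?_⟩
    filter_upwards [h1 (isOpen_interior.mem_nhds hx), h2 (isOpen_interior.mem_nhds hx),
      self_mem_nhdsWithin] with h a b c
    exact ⟨interior_subset a, interior_subset b, c⟩
  have h3 := (hf.tendsto_slope hx v).add ((hf x (interior_subset hx) w).comp hl)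
  refine tendsto_nhds_unique (hf.tendsto_slope hx (v + w)) (h3.congr fun h => ?_)
  simp only [Function.comp, diffQuot, ← smul_add]
  congr 1
  rw [smul_add, ← add_assoc]
  abel

omit [TopologicalSpace X] [IsTopologicalAddGroup X] [IsTopologicalAddGroup Y]
  [ContinuousSMul ℝ X] in
theorem smul_of_tendsto_slope {f : X → Y} {f' : X × X → Y} {x : X}
    (hf : ∀ v, Filter.Tendsto (fun h : ℝ => h⁻¹ • (f (x + h • v) - f x)) (𝓝[≠] 0) (𝓝 (f' (x, v))))
    {a : ℝ} (ha : a ≠ 0) (v : X) : f' (x, a • v) = a • f' (x, v) := by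
  have h1 : Filter.Tendsto (fun k : ℝ => k * a) (𝓝[≠] 0) (𝓝[≠] 0) := by
    refine tendsto_nhdsWithin_iff.2 ⟨?_, ?_⟩
    · simpa using ((continuous_id.mul continuous_const).tendsto (0 : ℝ)).mono_left
        (nhdsWithin_le_nhds (s := {0}ᶜ)) (f := fun k : ℝ => k * a)
    · filter_upwards [self_mem_nhdsWithin] with k hk using mul_ne_zero hk ha
  refine tendsto_nhds_unique (hf (a • v)) ((((hf v).comp h1).const_smul a).congr fun h => ?_)
  simp only [Function.comp, smul_smul, mul_inv]
  congr 1
  field_simp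

omit [IsTopologicalAddGroup X] [ContinuousSMul ℝ X] [IsTopologicalAddGroup Y]
  [ContinuousSMul ℝ Y] [T2Space Y] in
theorem LCSmoothOn.continuousOn {s : Set X} {f : X → Y} (hf : LCSmoothOn s f) :
    ContinuousOn f s := by
  obtain ⟨D, hD0, hDc, -⟩ := hf
  refine ((hDc 0).comp (f := fun x => (x, Fin.elim0)) (by fun_prop)
    fun x hx => ⟨hx, mem_univ _⟩).congr fun x hx => ?_
  exact (hD0 x hx _).symm

end

/-- The sum `∑ᵢ D n x (uᵢ, v₁, …, v̂ᵢ, …, vₙ)` for `w = ((v₁, u₁), …, (vₙ, uₙ))`: the part of the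
`n`-th iterated differential of `(x, v) ↦ D 1 x v` in directions `w` in which `v` has been
differentiated. -/
def derivSum (D : (n : ℕ) → X → (Fin n → X) → Y) : (n : ℕ) → X → (Fin n → X × X) → Y
  | 0, _, _ => 0
  | n + 1, x, w =>
    ∑ i : Fin (n + 1), D (n + 1) x (Fin.cons (w i).2 fun j : Fin n => (w (i.succAbove j)).1)

/-- If `f` has iterated differentials `D n`, then `(x, v) ↦ D 1 x v` has as `n`-th iterated
differential, in directions `(wᵢ, uᵢ)`,
`D (n + 1) x (v, w₁, …, wₙ) + ∑ᵢ D n x (uᵢ, w₁, …, ŵᵢ, …, wₙ)`.  This needs only that `D (n + 1)`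
is linear in its first direction, which it inherits from `D 1`. -/
theorem LCSmoothOn.deriv [LocallyConvexSpace ℝ X] [LocallyConvexSpace ℝ Y] {s : Set X}
    (hs : RelOpenInConvex s) {f : X → Y} (hf : LCSmoothOn s f) :
    ∃ f' : X × X → Y, StrictDirDiffOn s f f' ∧ LCSmoothOn (s ×ˢ univ) f' := by
  have hfc := hf.continuousOn
  obtain ⟨D, hD0, hDc, hD⟩ := hf
  have hmem : ∀ x ∈ interior s, ∀ v : X, ∀ᶠ h : ℝ in 𝓝[≠] 0, x + h • v ∈ interior s :=
    fun x hx v => tendsto_add_smul_punctured x v (isOpen_interior.mem_nhds hx)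
  have hcons : ∀ n, Continuous fun p : X × (Fin n → X) => (Fin.cons p.1 p.2 : Fin (n + 1) → X) :=
    fun n => continuous_pi fun i => Fin.cases continuous_fst
      (fun j => (continuous_apply j).comp continuous_snd) i
  let f' : X × X → Y := fun p => D 1 p.1 (Fin.cons p.2 Fin.elim0)
  have hf'c : ContinuousOn f' (s ×ˢ univ) :=
    (hDc 1).comp (f := fun p : X × X => (p.1, (Fin.cons p.2 Fin.elim0 : Fin 1 → X)))
      (continuous_fst.prodMk ((hcons 0).comp
        (continuous_snd.prodMk continuous_const))).continuousOn fun p hp => ⟨hp.1, mem_univ _⟩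
  have hslope : ∀ x ∈ interior s, ∀ v, Filter.Tendsto (fun h : ℝ => h⁻¹ • (f (x + h • v) - f x))
      (𝓝[≠] 0) (𝓝 (f' (x, v))) := fun x hx v => by
    refine (hD 0 x hx (Fin.cons v Fin.elim0)).congr' ?_
    filter_upwards [hmem x hx v] with h hh
    rw [hD0 _ (interior_subset hx),
      show (Fin.cons v Fin.elim0 : Fin 1 → X) (Fin.last 0) = v from rfl, hD0 _ (interior_subset hh)]
  have hstrict : StrictDirDiffOn s f f' := hs.strictDirDiffOn hfc hf'c hslope
  have hD' : ∀ n : ℕ, ∀ x ∈ interior s, ∀ (a : X) (w : Fin (n + 1) → X), Filter.Tendsto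
      (fun h : ℝ => h⁻¹ • (D (n + 1) (x + h • w (Fin.last n)) (Fin.cons a (Fin.init w)) -
        D (n + 1) x (Fin.cons a (Fin.init w)))) (𝓝[≠] 0) (𝓝 (D (n + 2) x (Fin.cons a w))) := by
    intro n x hx a w
    have h1 : Fin.init (Fin.cons a w : Fin (n + 2) → X) = Fin.cons a (Fin.init w) := by
      conv_lhs => rw [← Fin.snoc_init_self w]
      rw [Fin.cons_snoc_eq_snoc_cons, Fin.init_snoc]
    have h2 : (Fin.cons a w : Fin (n + 2) → X) (Fin.last (n + 1)) = w (Fin.last n) := rfl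
    have := hD (n + 1) x hx (Fin.cons a w)
    rwa [h1, h2] at this
  -- linearity of `D (n + 1)` in the first direction, by induction on `n`
  have hadd : ∀ n : ℕ, ∀ x ∈ interior s, ∀ (v u : X) (w : Fin n → X),
      D (n + 1) x (Fin.cons (v + u) w) =
        D (n + 1) x (Fin.cons v w) + D (n + 1) x (Fin.cons u w) := by
    intro n
    induction n with
    | zero =>
      intro x hx v u w
      rw [Subsingleton.elim w Fin.elim0]
      exact hstrict.add_direction hx v u
    | succ n ih =>
      intro x hx v u w
      refine tendsto_nhds_unique (hD' n x hx (v + u) w)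
        (((hD' n x hx v w).add (hD' n x hx u w)).congr' ?_)
      filter_upwards [hmem x hx (w (Fin.last n))] with h hh
      rw [ih _ hh, ih _ hx, ← smul_add]
      congr 1
      abel
  have hsmul : ∀ n : ℕ, ∀ x ∈ interior s, ∀ (a : ℝ), a ≠ 0 → ∀ (v : X) (w : Fin n → X),
      D (n + 1) x (Fin.cons (a • v) w) = a • D (n + 1) x (Fin.cons v w) := by
    intro n
    induction n with
    | zero =>
      intro x hx a ha v w
      rw [Subsingleton.elim w Fin.elim0]
      exact smul_of_tendsto_slope (f' := f') (hslope x hx) ha v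
    | succ n ih =>
      intro x hx a ha v w
      refine tendsto_nhds_unique (hD' n x hx (a • v) w)
        (((hD' n x hx v w).const_smul a).congr' ?_)
      filter_upwards [hmem x hx (w (Fin.last n))] with h hh
      rw [ih _ hh _ ha, ih _ hx _ ha, ← smul_sub, smul_comm]
  have hS : ∀ n : ℕ, ∀ x ∈ interior s, ∀ w : Fin (n + 1) → X × X, Filter.Tendsto
      (fun h : ℝ => h⁻¹ • (derivSum D n (x + h • (w (Fin.last n)).1) (Fin.init w) -
        derivSum D n x (Fin.init w))) (𝓝[≠] 0)
      (𝓝 (derivSum D (n + 1) x w -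
        D (n + 1) x (Fin.cons (w (Fin.last n)).2 fun j => (w j.castSucc).1))) := by
    intro n x hx w
    rw [derivSum, Fin.sum_univ_castSucc]
    simp only [Fin.succAbove_last, add_sub_cancel_right]
    cases n with
    | zero => simp [derivSum]
    | succ n =>
      simp only [derivSum, ← Finset.sum_sub_distrib, Finset.smul_sum]
      refine tendsto_finsetSum _ fun i _ => ?_
      have := hD' n x hx (w i.castSucc).2 (fun j => (w (i.castSucc.succAbove j)).1)
      simpa only [Fin.init_def, Fin.castSucc_succAbove_castSucc,
        Fin.succAbove_castSucc_of_le _ _ (Fin.le_last i), Fin.succ_last] using this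
  refine ⟨f', hstrict, fun n p w => D (n + 1) p.1 (Fin.cons p.2 fun j => (w j).1) +
    derivSum D n p.1 w, ?_, ?_, ?_⟩
  · intro p _ w
    simp only [derivSum, add_zero, f']
    rw [Subsingleton.elim (fun j => (w j).1) Fin.elim0]
  · intro n
    refine ContinuousOn.add ?_ ?_
    · exact (hDc (n + 1)).comp
        (f := fun q : (X × X) × (Fin n → X × X) =>
          (q.1.1, (Fin.cons q.1.2 fun j => (q.2 j).1 : Fin (n + 1) → X)))
        ((by fun_prop : Continuous fun q : (X × X) × (Fin n → X × X) => q.1.1).prodMk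
          ((hcons n).comp (f := fun q : (X × X) × (Fin n → X × X) => (q.1.2, fun j => (q.2 j).1))
            (by fun_prop))).continuousOn fun q hq => ⟨hq.1.1, mem_univ _⟩
    · cases n with
      | zero => exact continuousOn_const
      | succ n =>
        refine continuousOn_finsetSum _ fun i _ => ?_
        exact (hDc (n + 1)).comp (f := fun q : (X × X) × (Fin (n + 1) → X × X) =>
          (q.1.1, (Fin.cons (q.2 i).2 fun j => (q.2 (i.succAbove j)).1 : Fin (n + 1) → X)))
          ((by fun_prop : Continuous fun q : (X × X) × (Fin (n + 1) → X × X) => q.1.1).prodMk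
            ((hcons n).comp (f := fun q : (X × X) × (Fin (n + 1) → X × X) =>
              ((q.2 i).2, fun j => (q.2 (i.succAbove j)).1)) (by fun_prop))).continuousOn
          fun q hq => ⟨hq.1.1, mem_univ _⟩
  · rintro n ⟨x, v⟩ hx w
    rw [interior_prod_eq] at hx
    have hx : x ∈ interior s := hx.1
    -- differentiate in the base point, then in `v`
    have h1 := hD' n x hx v (fun j => (w j).1)
    have h2 : Filter.Tendsto (fun h : ℝ => D (n + 1) (x + h • (w (Fin.last n)).1)
        (Fin.cons (w (Fin.last n)).2 fun j => (w j.castSucc).1)) (𝓝[≠] 0)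
        (𝓝 (D (n + 1) x (Fin.cons (w (Fin.last n)).2 fun j => (w j.castSucc).1))) := by
      refine Filter.Tendsto.comp (((hDc (n + 1)).continuousAt (x := (x, Fin.cons (w (Fin.last n)).2
        fun j => (w j.castSucc).1)) ?_).tendsto)
        ((tendsto_add_smul_punctured x (w (Fin.last n)).1).prodMk_nhds tendsto_const_nhds)
      exact prod_mem_nhds (mem_interior_iff_mem_nhds.1 hx) Filter.univ_mem
    have h3 := (h1.add h2).add (hS n x hx w)
    rw [add_assoc, add_sub_cancel] at h3
    refine h3.congr' ?_
    filter_upwards [hmem x hx (w (Fin.last n)).1, self_mem_nhdsWithin] with h hh hne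
    simp only [Prod.fst_add, Prod.snd_add, Prod.smul_fst, Prod.smul_snd]
    rw [hadd n _ hh, hsmul n _ hh h hne]
    simp only [Fin.init_def, smul_sub, smul_add, inv_smul_smul₀ hne]
    abel

/-- Smoothness in the interior with differentials that extend continuously implies smoothness in the
strict sense, provided that the set is locally convex. -/
theorem LCSmoothOn.cinftyOn [LocallyConvexSpace ℝ X] [LocallyConvexSpace ℝ Y] {s : Set X}
    (hs : RelOpenInConvex s) {f : X → Y} (hf : LCSmoothOn s f) : CinftyOn s f := by
  intro n
  induction n generalizing X with
  | zero => exact hf.continuousOn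
  | succ n ih =>
    obtain ⟨f', hf', hs'⟩ := hf.deriv hs
    exact CkOn.intro hs.fat hf.continuousOn hf' (ih hs.prod_univ hs')

end Comparison

section Normed

universe u v

variable {X : Type u} {Y : Type v} [NormedAddCommGroup X] [NormedSpace ℝ X] [NormedAddCommGroup Y]
  [NormedSpace ℝ Y]

theorem RelOpenInConvex.uniqueDiffOn {s : Set X} (hs : RelOpenInConvex s) : UniqueDiffOn ℝ s := by
  obtain ⟨Q, Ω, hQ, hQf, hΩ, rfl⟩ := hs
  rcases Q.eq_empty_or_nonempty with rfl | ⟨x, hx⟩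
  · rw [empty_inter]; exact uniqueDiffOn_empty
  · exact (uniqueDiffOn_convex hQ (closure_nonempty_iff.1 ⟨x, hQf hx⟩)).inter hΩ

theorem ContDiffOn.cinftyOn {s : Set X} (hs : RelOpenInConvex s) {f : X → Y}
    (hf : ContDiffOn ℝ ∞ f s) : CinftyOn s f := by
  intro n
  induction n generalizing X with
  | zero => exact hf.continuousOn
  | succ n ih =>
    have hu := hs.uniqueDiffOn
    have hd : ContDiffOn ℝ ∞ (fun p : X × X => fderivWithin ℝ f s p.1 p.2) (s ×ˢ univ) :=
      contDiffOn_fderivWithin_apply hf hu (by simp)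
    refine CkOn.intro hs.fat hf.continuousOn
      (hs.strictDirDiffOn hf.continuousOn hd.continuousOn fun x hx v => ?_) (ih hs.prod_univ hd)
    have h1 : HasFDerivAt f (fderivWithin ℝ f s x) x :=
      ((hf.differentiableOn (by simp)) x (interior_subset hx)).hasFDerivWithinAt.hasFDerivAt
        (mem_interior_iff_mem_nhds.1 hx)
    have h2 := (h1.hasLineDerivAt v).tendsto_slope_zero
    exact h2

end Normed

/-! ### Smoothness in a chart -/

section Charts

/-- The model spaces under consideration: `ι` embeds the model space `H` into a topological vector
space `X` as a convex set with dense interior. -/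
structure IsConvexModel {H X : Type*} [TopologicalSpace H] [AddCommGroup X] [Module ℝ X]
    [TopologicalSpace X] (ι : H → X) : Prop where
  isEmbedding : IsEmbedding ι
  convex_range : Convex ℝ (range ι)
  fat_range : Fat (range ι)

variable {H X M : Type*} [TopologicalSpace H] [Nonempty H] [AddCommGroup X] [Module ℝ X]
  [TopologicalSpace X] {ι : H → X} [TopologicalSpace M]

/-- The image of `W` under the chart `e`, as a subset of the ambient vector space. -/
def chartImage (ι : H → X) (e : OpenPartialHomeomorph M H) (W : Set M) : Set X :=
  (fun p => ι (e p)) '' (W ∩ e.source)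

/-- The inverse of the chart `e`, as a map on the ambient vector space (with junk values outside the
image of the model space). -/
noncomputable def chartInv (ι : H → X) (e : OpenPartialHomeomorph M H) (x : X) : M :=
  e.symm (Function.invFun ι x)

theorem chartInv_apply (hι : IsConvexModel ι) (e : OpenPartialHomeomorph M H) {p : M}
    (hp : p ∈ e.source) : chartInv ι e (ι (e p)) = p := by
  rw [chartInv, Function.leftInverse_invFun hι.isEmbedding.injective, e.left_inv hp]

omit [Nonempty H] in
/-- An open set of the manifold is cut out, in the chart `e`, by an open set of the ambient vector
space. -/
theorem exists_chartImage_inter (hι : IsConvexModel ι) (e : OpenPartialHomeomorph M H) {G : Set M}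
    (hG : IsOpen G) : ∃ Ω : Set X, IsOpen Ω ∧ (∀ p ∈ e.source, ι (e p) ∈ Ω ↔ p ∈ G) ∧
      ∀ W, chartImage ι e (W ∩ G) = chartImage ι e W ∩ Ω := by
  obtain ⟨Ω, hΩ, hΩG⟩ := hι.isEmbedding.isOpen_iff.1
    (e.isOpen_image_of_subset_source (s := e.source ∩ G) (e.open_source.inter hG)
      inter_subset_left)
  have key : ∀ p ∈ e.source, ι (e p) ∈ Ω ↔ p ∈ G := by
    intro p hp
    rw [← mem_preimage, hΩG]
    constructor
    · rintro ⟨q, hq, hqp⟩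
      rw [← e.injOn hq.1 hp hqp]
      exact hq.2
    · exact fun h => ⟨p, ⟨hp, h⟩, rfl⟩
  refine ⟨Ω, hΩ, key, fun W => ?_⟩
  ext x
  constructor
  · rintro ⟨p, ⟨⟨hW, hGp⟩, hp⟩, rfl⟩
    exact ⟨⟨p, ⟨hW, hp⟩, rfl⟩, (key p hp).2 hGp⟩
  · rintro ⟨⟨p, ⟨hW, hp⟩, rfl⟩, hΩp⟩
    exact ⟨p, ⟨⟨hW, (key p hp).1 hΩp⟩, hp⟩, rfl⟩

omit [Nonempty H] in
theorem relOpenInConvex_chartImage (hι : IsConvexModel ι) (e : OpenPartialHomeomorph M H)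
    {W : Set M} (hW : IsOpen W) : RelOpenInConvex (chartImage ι e W) := by
  obtain ⟨Ω, hΩ, hΩG⟩ := hι.isEmbedding.isOpen_iff.1
    (e.isOpen_image_of_subset_source (s := W ∩ e.source) (hW.inter e.open_source)
      inter_subset_right)
  refine ⟨range ι, Ω, hι.convex_range, hι.fat_range, hΩ, ?_⟩
  ext x
  constructor
  · rintro ⟨p, hp, rfl⟩
    exact ⟨mem_range_self _, by rw [← mem_preimage, hΩG]; exact ⟨p, hp, rfl⟩⟩
  · rintro ⟨⟨y, rfl⟩, hy⟩
    rw [← mem_preimage, hΩG] at hy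
    obtain ⟨p, hp, rfl⟩ := hy
    exact ⟨p, hp, rfl⟩

variable {Z Z' : Type*} [AddCommGroup Z] [Module ℝ Z] [TopologicalSpace Z]
  [AddCommGroup Z'] [Module ℝ Z'] [TopologicalSpace Z']

/-- The vector-valued map `u` is smooth on the part of `W` covered by the chart `e`. -/
def SmoothInChart (ι : H → X) (e : OpenPartialHomeomorph M H) (W : Set M) (u : M → Z) : Prop :=
  CinftyOn (chartImage ι e W) (u ∘ chartInv ι e)

theorem SmoothInChart.congr (hι : IsConvexModel ι) {e : OpenPartialHomeomorph M H} {W : Set M}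
    {u v : M → Z} (hu : SmoothInChart ι e W u) (h : ∀ p ∈ W, p ∈ e.source → u p = v p) :
    SmoothInChart ι e W v := fun n => (hu n).congr <| by
  rintro _ ⟨p, hp, rfl⟩
  simp only [Function.comp, chartInv_apply hι e hp.2, h p hp.1 hp.2]

variable [IsTopologicalAddGroup X] [ContinuousSMul ℝ X]

theorem SmoothInChart.inter_isOpen (hι : IsConvexModel ι) {e : OpenPartialHomeomorph M H}
    {W G : Set M} {u : M → Z} (hu : SmoothInChart ι e W u) (hG : IsOpen G) :
    SmoothInChart ι e (W ∩ G) u := fun n => by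
  obtain ⟨Ω, hΩ, -, h⟩ := exists_chartImage_inter hι e hG
  rw [h]
  exact (hu n).inter_isOpen hΩ

theorem SmoothInChart.mono (hι : IsConvexModel ι) {e : OpenPartialHomeomorph M H}
    {W G : Set M} {u : M → Z} (hu : SmoothInChart ι e W u) (hG : IsOpen G) (hGW : G ⊆ W) :
    SmoothInChart ι e G u := by
  rw [← inter_eq_self_of_subset_right hGW]
  exact hu.inter_isOpen hι hG

theorem SmoothInChart.of_locally (hι : IsConvexModel ι) {e : OpenPartialHomeomorph M H}
    {W : Set M} {u : M → Z}
    (h : ∀ p ∈ W, p ∈ e.source → ∃ G, IsOpen G ∧ p ∈ G ∧ SmoothInChart ι e (W ∩ G) u) :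
    SmoothInChart ι e W u := fun n => CkOn.of_locally <| by
  rintro _ ⟨p, hp, rfl⟩
  obtain ⟨G, hG, hpG, hu⟩ := h p hp.1 hp.2
  obtain ⟨Ω, hΩ, h1, h2⟩ := exists_chartImage_inter hι e hG
  refine ⟨Ω, hΩ, (h1 p hp.2).2 hpG, ?_⟩
  rw [← h2]
  exact hu n

theorem SmoothInChart.comp [T2Space Z] [T2Space Z'] (hι : IsConvexModel ι)
    {e : OpenPartialHomeomorph M H}
    {W : Set M} (hW : IsOpen W) {u : M → Z} {t : Set Z} {g : Z → Z'} (hg : CinftyOn t g)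
    (hu : SmoothInChart ι e W u) (ht : ∀ p ∈ W, p ∈ e.source → u p ∈ t) :
    SmoothInChart ι e W (g ∘ u) := fun n => by
  refine CkOn.comp (f := u ∘ chartInv ι e) (g := g) (relOpenInConvex_chartImage hι e hW).fat
    (hg n) (hu n) ?_
  rintro _ ⟨p, hp, rfl⟩
  simpa only [Function.comp, chartInv_apply hι e hp.2] using ht p hp.1 hp.2

/-- The chain rule for a map `f` between manifolds, given in charts `e` and `e'`. -/
theorem SmoothInChart.comp_map {H' X' M' : Type*} [TopologicalSpace H'] [Nonempty H']
    [AddCommGroup X'] [Module ℝ X'] [TopologicalSpace X'] {ι' : H' → X'} [TopologicalSpace M']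
    [T2Space X'] [T2Space Z] (hι : IsConvexModel ι) (hι' : IsConvexModel ι')
    {e : OpenPartialHomeomorph M H} {e' : OpenPartialHomeomorph M' H'} {W : Set M} (hW : IsOpen W)
    {V : Set M'} {f : M → M'} {u : M' → Z} (hu : SmoothInChart ι' e' V u)
    (hf : SmoothInChart ι e W fun p => ι' (e' (f p)))
    (h : ∀ p ∈ W, p ∈ e.source → f p ∈ V ∧ f p ∈ e'.source) :
    SmoothInChart ι e W (u ∘ f) := by
  refine (SmoothInChart.comp hι hW hu hf fun p hp hpe => ⟨f p, h p hp hpe, rfl⟩).congr hι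
    fun p hp hpe => ?_
  simp only [Function.comp, chartInv_apply hι' e' (h p hp hpe).2]

theorem smoothInChart_self [T2Space X] (hι : IsConvexModel ι) (e : OpenPartialHomeomorph M H)
    {W : Set M} (hW : IsOpen W) : SmoothInChart ι e W fun p => ι (e p) := fun n => by
  refine ((ContinuousLinearMap.id ℝ X).ckOn (relOpenInConvex_chartImage hι e hW).fat n).congr ?_
  rintro _ ⟨p, hp, rfl⟩
  simp only [Function.comp, chartInv_apply hι e hp.2, ContinuousLinearMap.id_apply]

end Charts

/-! ### Smooth maps between manifolds -/

section Manifolds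

variable {H X M H' X' M' : Type*} [TopologicalSpace H] [Nonempty H] [AddCommGroup X] [Module ℝ X]
  [TopologicalSpace X] {ι : H → X} [TopologicalSpace M] [ChartedSpace H M]
  [IsTopologicalAddGroup X] [ContinuousSMul ℝ X] [LocallyConvexSpace ℝ X]
  [TopologicalSpace H'] [AddCommGroup X'] [Module ℝ X']
  [TopologicalSpace X'] {ι' : H' → X'} [TopologicalSpace M'] [ChartedSpace H' M']
  [IsTopologicalAddGroup X'] [ContinuousSMul ℝ X'] [LocallyConvexSpace ℝ X'] [T2Space X']

theorem lcManifoldSmoothOn_iff (hι : IsConvexModel ι) {f : M → M'} {W : Set M} (hW : IsOpen W) :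
    LCManifoldSmoothOn ι ι' f W ↔ ContinuousOn f W ∧ ∀ e ∈ atlas H M, ∀ e' ∈ atlas H' M',
      SmoothInChart ι e (W ∩ f ⁻¹' e'.source) fun p => ι' (e' (f p)) := by
  refine and_congr_right fun hf => forall₄_congr fun e he e' he' => ?_
  have hO : IsOpen (W ∩ f ⁻¹' e'.source) := hf.isOpen_inter_preimage hW e'.open_source
  have hr := relOpenInConvex_chartImage hι e hO
  have hset : (fun p => ι (e p)) '' (W ∩ e.source ∩ f ⁻¹' e'.source) =
      chartImage ι e (W ∩ f ⁻¹' e'.source) := by rw [chartImage, inter_right_comm]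
  rw [hset]
  constructor
  · rintro ⟨g, hg, hgf⟩ n
    refine (hg.cinftyOn hr n).congr ?_
    rintro _ ⟨p, hp, rfl⟩
    simp only [Function.comp, chartInv_apply hι e hp.2]
    exact hgf p ⟨⟨hp.1.1, hp.2⟩, hp.1.2⟩
  · intro h
    refine ⟨_, CinftyOn.lcSmoothOn hr.fat h, fun p hp => ?_⟩
    simp only [Function.comp, chartInv_apply hι e hp.1.2]

theorem LCManifoldSmoothOn.mono (hι : IsConvexModel ι) {f : M → M'} {W G : Set M}
    (hf : LCManifoldSmoothOn ι ι' f W) (hW : IsOpen W) (hG : IsOpen G) (hGW : G ⊆ W) :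
    LCManifoldSmoothOn ι ι' f G := by
  rw [lcManifoldSmoothOn_iff hι hW] at hf
  rw [lcManifoldSmoothOn_iff hι hG]
  have hc := hf.1.mono hGW
  exact ⟨hc, fun e he e' he' => (hf.2 e he e' he').mono hι
    (hc.isOpen_inter_preimage hG e'.open_source) (inter_subset_inter_left _ hGW)⟩

theorem LCManifoldSmoothOn.congr (hι : IsConvexModel ι) {f g : M → M'} {W : Set M} (hW : IsOpen W)
    (hf : LCManifoldSmoothOn ι ι' f W) (h : EqOn f g W) : LCManifoldSmoothOn ι ι' g W := by
  rw [lcManifoldSmoothOn_iff hι hW] at hf ⊢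
  refine ⟨hf.1.congr h.symm, fun e he e' he' => ?_⟩
  have : W ∩ g ⁻¹' e'.source = W ∩ f ⁻¹' e'.source := by
    ext p
    simp only [mem_inter_iff, mem_preimage]
    exact and_congr_right fun hp => by rw [h hp]
  rw [this]
  exact (hf.2 e he e' he').congr hι fun p hp _ => by rw [h hp.1]

theorem LCManifoldSmoothOn.of_locally (hι : IsConvexModel ι) {f : M → M'} {W : Set M}
    (hW : IsOpen W) (h : ∀ p ∈ W, ∃ G, IsOpen G ∧ p ∈ G ∧ LCManifoldSmoothOn ι ι' f G) :
    LCManifoldSmoothOn ι ι' f W := by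
  have hc : ContinuousOn f W := continuousOn_of_locally_continuousOn fun p hp =>
    let ⟨G, hG, hpG, hf⟩ := h p hp
    ⟨G, hG, hpG, hf.1.mono inter_subset_right⟩
  rw [lcManifoldSmoothOn_iff hι hW]
  refine ⟨hc, fun e he e' he' => SmoothInChart.of_locally hι fun p hp hpe => ?_⟩
  obtain ⟨G, hG, hpG, hf⟩ := h p hp.1
  refine ⟨G, hG, hpG, (((lcManifoldSmoothOn_iff hι hG).1 hf).2 e he e' he').mono hι
    ((hc.isOpen_inter_preimage hW e'.open_source).inter hG) fun q hq => ⟨hq.2, hq.1.2⟩⟩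

end Manifolds

/-! ### The model spaces of the base and of the total space -/

section Quadrant

theorem isConvexModel_quadrantIncl (d : ℕ) : IsConvexModel (quadrantIncl d) where
  isEmbedding := (modelWithCornersEuclideanQuadrant d).isClosedEmbedding.isEmbedding
  convex_range := (modelWithCornersEuclideanQuadrant d).convex_range
  fat_range := (modelWithCornersEuclideanQuadrant d).range_subset_closure_interior

theorem isConvexModel_quadrantProdIncl (d : ℕ) (Y : Type*) [AddCommGroup Y] [Module ℝ Y]
    [TopologicalSpace Y] : IsConvexModel (quadrantProdIncl d Y) := by
  have h := isConvexModel_quadrantIncl d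
  have hr : range (quadrantProdIncl d Y) = range (quadrantIncl d) ×ˢ (univ : Set Y) := by
    have : quadrantProdIncl d Y = Prod.map (quadrantIncl d) id := rfl
    rw [this]
    exact (range_prodMap).trans (by rw [range_id])
  refine ⟨h.isEmbedding.prodMap IsEmbedding.id, ?_, ?_⟩
  · rw [hr]; exact h.convex_range.prod convex_univ
  · rw [hr]; exact h.fat_range.prod_univ

theorem smoothInChart_coordChange (d : ℕ) {M : Type*} [TopologicalSpace M]
    [ChartedSpace (EuclideanQuadrant d) M]
    [IsManifold (modelWithCornersEuclideanQuadrant d) ∞ M]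
    {e e' : OpenPartialHomeomorph M (EuclideanQuadrant d)} (he : e ∈ atlas (EuclideanQuadrant d) M)
    (he' : e' ∈ atlas (EuclideanQuadrant d) M) :
    SmoothInChart (quadrantIncl d) e e'.source fun p => quadrantIncl d (e' p) := by
  let I := modelWithCornersEuclideanQuadrant d
  have h : ContDiffOn ℝ ∞ (I.extendCoordChange e e') (I.extendCoordChange e e').source :=
    I.contDiffOn_extendCoordChange (IsManifold.subset_maximalAtlas he)
      (IsManifold.subset_maximalAtlas he')
  have hι := isConvexModel_quadrantIncl d
  refine fun n => CkOn.congr (ContDiffOn.cinftyOn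
    (relOpenInConvex_chartImage hι e e'.open_source) (h.mono ?_) n) ?_
  · rintro _ ⟨p, hp, rfl⟩
    have h1 : I.symm (quadrantIncl d (e p)) = e p := I.left_inv (e p)
    have h2 : quadrantIncl d (e p) ∈ range I := mem_range_self (e p)
    simp [ModelWithCorners.extendCoordChange, h1, h2, hp.2, hp.1]
  · rintro _ ⟨p, hp, rfl⟩
    have h1 : I.symm (quadrantIncl d (e p)) = e p := I.left_inv (e p)
    simp only [Function.comp, chartInv_apply hι e hp.2]
    simp [ModelWithCorners.extendCoordChange, h1, hp.2]
    rfl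

end Quadrant

/-! ### Sections in local trivialisations -/

section Sections

instance (d : ℕ) (Y : Type*) [Zero Y] : Nonempty (ModelProd (EuclideanQuadrant d) Y) :=
  inferInstanceAs (Nonempty (EuclideanQuadrant d × Y))

variable {d : ℕ} {M : Type*} [TopologicalSpace M] [ChartedSpace (EuclideanQuadrant d) M]
  {Y : Type*} [AddCommGroup Y] [Module ℝ Y] [TopologicalSpace Y] [T2Space Y]
  [IsTopologicalAddGroup Y] [ContinuousSMul ℝ Y] [LocallyConvexSpace ℝ Y]
  {N : Type*} [TopologicalSpace N] [ChartedSpace Y N]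
  {E : Type*} [TopologicalSpace E] [ChartedSpace (ModelProd (EuclideanQuadrant d) Y) E]
  {π : E → M} {φ : Bundle.Trivialization N π}

/-- The fibre coordinate of a smooth section, in a smooth local trivialisation and a chart of the
typical fibre, is smooth. -/
theorem smoothInChart_fibreCoord
    (hφ : LCManifoldSmoothOn (quadrantProdIncl d Y) (quadrantProdIncl d Y) (φ : E → M × N) φ.source)
    {σ : M → E} {W : Set M} (hW : IsOpen W)
    (hσ : LCManifoldSmoothOn (quadrantIncl d) (quadrantProdIncl d Y) σ W)
    {c : OpenPartialHomeomorph N Y} (hc : c ∈ atlas Y N)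
    (h : ∀ x ∈ W, π (σ x) = x ∧ σ x ∈ φ.source ∧ (φ (σ x)).2 ∈ c.source)
    {e : OpenPartialHomeomorph M (EuclideanQuadrant d)} (he : e ∈ atlas (EuclideanQuadrant d) M) :
    SmoothInChart (quadrantIncl d) e W fun x => c (φ (σ x)).2 := by
  have hι := isConvexModel_quadrantIncl d
  have hιE := isConvexModel_quadrantProdIncl d Y
  rw [lcManifoldSmoothOn_iff hιE φ.open_source] at hφ
  rw [lcManifoldSmoothOn_iff hι hW] at hσ
  refine SmoothInChart.of_locally hι fun p hp hpe => ?_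
  set e' := chartAt (ModelProd (EuclideanQuadrant d) Y) (σ p) with he'
  have hG : IsOpen (W ∩ σ ⁻¹' e'.source) := hσ.1.isOpen_inter_preimage hW e'.open_source
  refine ⟨_, hG, ⟨hp, mem_chart_source _ (σ p)⟩, ?_⟩
  rw [← inter_assoc, inter_self]
  have h1 := hφ.2 e' (chart_mem_atlas _ _) (e.prod c) (mem_image2_of_mem he hc)
  have h2 := hσ.2 e he e' (chart_mem_atlas _ _)
  have h3 := SmoothInChart.comp_map hι hιE hG h1 h2 fun q hq hqe =>
    ⟨⟨(h q hq.1).2.1, by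
      have hfst : (φ (σ q)).1 = q := by rw [φ.coe_fst (h q hq.1).2.1, (h q hq.1).1]
      exact ⟨by rw [hfst]; exact hqe, (h q hq.1).2.2⟩⟩, hq.2⟩
  exact SmoothInChart.comp (t := univ) (g := Prod.snd)
    (u := fun x => quadrantProdIncl d Y ((e.prod c) (φ (σ x)))) hι hG
    (fun n => (ContinuousLinearMap.snd ℝ (EuclideanSpace ℝ (Fin d)) Y).ckOn fat_univ n) h3
    fun _ _ _ => mem_univ _

/-- A section whose fibre coordinate `u` is smooth is smooth. -/
theorem lcManifoldSmoothOn_of_fibreCoord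
    (hφ : LCManifoldSmoothOn (quadrantProdIncl d Y) (quadrantProdIncl d Y)
      (φ.toOpenPartialHomeomorph.symm : M × N → E) φ.target)
    {W : Set M} (hW : IsOpen W) (hWφ : W ⊆ φ.baseSet)
    {c : OpenPartialHomeomorph N Y} (hc : c ∈ atlas Y N) {u : M → Y} (huc : ContinuousOn u W)
    (hut : MapsTo u W c.target)
    (hu : ∀ e ∈ atlas (EuclideanQuadrant d) M, SmoothInChart (quadrantIncl d) e W u) :
    LCManifoldSmoothOn (quadrantIncl d) (quadrantProdIncl d Y)
      (fun x => φ.toOpenPartialHomeomorph.symm (x, c.symm (u x))) W := by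
  have hι := isConvexModel_quadrantIncl d
  have hιE := isConvexModel_quadrantProdIncl d Y
  rw [lcManifoldSmoothOn_iff hιE φ.open_target] at hφ
  have hf : ContinuousOn (fun x => (x, c.symm (u x))) W :=
    continuousOn_id.prodMk (c.continuousOn_symm.comp huc hut)
  have hft : MapsTo (fun x => (x, c.symm (u x))) W φ.target := fun x hx => by
    rw [φ.mem_target]; exact hWφ hx
  have hcont := hφ.1.comp hf hft
  rw [lcManifoldSmoothOn_iff hι hW]
  refine ⟨hcont, fun e he e' he' => ?_⟩
  have hG := hcont.isOpen_inter_preimage hW e'.open_source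
  have h1 := hφ.2 (e.prod c) (mem_image2_of_mem he hc) e' he'
  have h2 : SmoothInChart (quadrantIncl d) e
      (W ∩ (fun x => φ.toOpenPartialHomeomorph.symm (x, c.symm (u x))) ⁻¹' e'.source)
      fun x => quadrantProdIncl d Y ((e.prod c) (x, c.symm (u x))) := by
    have h3 : SmoothInChart (quadrantIncl d) e
        (W ∩ (fun x => φ.toOpenPartialHomeomorph.symm (x, c.symm (u x))) ⁻¹' e'.source)
        fun x => (quadrantIncl d (e x), u x) := fun n =>
      (smoothInChart_self hι e hG n).prodMk (relOpenInConvex_chartImage hι e hG).fat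
        ((hu e he).mono hι hG inter_subset_left n)
    refine h3.congr hι fun x hx hxe => ?_
    change (quadrantIncl d (e x), u x) = (quadrantIncl d (e x), c (c.symm (u x)))
    rw [c.right_inv (hut hx.1)]
  exact SmoothInChart.comp_map hι hιE hG h1 h2 fun q hq hqe =>
    ⟨⟨hft hq.1, hq.2⟩, ⟨hqe, c.map_target (hut hq.1)⟩⟩

end Sections

/-! ### Topology of the base -/

section Topology

/-- A connected paracompact locally compact space is `σ`-compact: starting from one member of a
locally finite cover by relatively compact open sets, adding repeatedly all members that meet the
compact set obtained so far exhausts an open and closed set. -/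
theorem sigmaCompactSpace_of_connectedSpace (M : Type*) [TopologicalSpace M] [T2Space M]
    [ParacompactSpace M] [ConnectedSpace M] [LocallyCompactSpace M] : SigmaCompactSpace M := by
  choose C hC hCx using fun x : M => exists_compact_mem_nhds x
  obtain ⟨v, hvo, hvc, hvf, hvC⟩ := precise_refinement (fun x => interior (C x))
    (fun x => isOpen_interior) (eq_univ_of_forall fun x =>
      mem_iUnion.2 ⟨x, mem_interior_iff_mem_nhds.2 (hCx x)⟩)
  have hvcomp : ∀ x, IsCompact (closure (v x)) := fun x =>
    (hC x).of_isClosed_subset isClosed_closure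
      (closure_minimal ((hvC x).trans interior_subset) (hC x).isClosed)
  obtain ⟨x₀⟩ := (inferInstance : Nonempty M)
  let step : Set M → Set M := fun T => ⋃ x ∈ {x | (v x ∩ T).Nonempty}, closure (v x)
  let T : ℕ → Set M := fun n => step^[n] {x₀}
  have hsucc : ∀ n, T (n + 1) = step (T n) := fun n => Function.iterate_succ_apply' _ _ _
  have hT : ∀ n, IsCompact (T n) := by
    intro n
    induction n with
    | zero => exact isCompact_singleton
    | succ n ih =>
      rw [hsucc]
      exact (hvf.finite_nonempty_inter_compact ih).isCompact_biUnion fun x _ => hvcomp x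
  have key : ∀ n x y, y ∈ T n → y ∈ v x → v x ⊆ ⋃ n, T n := fun n x y hy hyx z hz =>
    mem_iUnion.2 ⟨n + 1, by
      rw [hsucc]; exact mem_biUnion (show x ∈ {x | (v x ∩ T n).Nonempty} from ⟨y, hyx, hy⟩)
        (subset_closure hz)⟩
  have hcov : ∀ y, ∃ x, y ∈ v x := fun y => mem_iUnion.1 (hvc ▸ mem_univ y)
  have hopen : IsOpen (⋃ n, T n) := isOpen_iff_forall_mem_open.2 fun y hy => by
    obtain ⟨n, hn⟩ := mem_iUnion.1 hy
    obtain ⟨x, hx⟩ := hcov y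
    exact ⟨v x, key n x y hn hx, hvo x, hx⟩
  have hclosed : IsClosed (⋃ n, T n) := isClosed_of_closure_subset fun y hy => by
    obtain ⟨x, hx⟩ := hcov y
    obtain ⟨z, hzv, hz⟩ := mem_closure_iff.1 hy (v x) (hvo x) hx
    obtain ⟨n, hn⟩ := mem_iUnion.1 hz
    exact key n x z hn hzv hx
  have huniv := IsClopen.eq_univ ⟨hclosed, hopen⟩ ⟨x₀, mem_iUnion.2 ⟨0, mem_singleton x₀⟩⟩
  exact ⟨⟨T, hT, huniv⟩⟩

/-- The space is covered by compact sets `K n` contained in the interiors of a locally finite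
sequence of compact sets `C n`, each of which lies in one of the given neighbourhoods `S x`. -/
theorem exists_locallyFinite_compact_cover {M : Type*} [TopologicalSpace M] [T2Space M]
    [ParacompactSpace M] [ConnectedSpace M] [LocallyCompactSpace M] {S : M → Set M}
    (hS : ∀ x, S x ∈ 𝓝 x) :
    ∃ (a : ℕ → M) (K C : ℕ → Set M), (∀ n, IsCompact (K n)) ∧ (∀ n, IsCompact (C n)) ∧
      (∀ n, K n ⊆ interior (C n)) ∧ (∀ n, C n ⊆ S (a n)) ∧ (⋃ n, K n = univ) ∧
      LocallyFinite C := by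
  have := sigmaCompactSpace_of_connectedSpace M
  choose B hBx hBS hB using fun x => local_compact_nhds (hS x)
  obtain ⟨v, hvo, hvc, hvf, hvB⟩ := precise_refinement (fun x => interior (B x))
    (fun x => isOpen_interior) (eq_univ_of_forall fun x =>
      mem_iUnion.2 ⟨x, mem_interior_iff_mem_nhds.2 (hBx x)⟩)
  obtain ⟨w, hwc, hwo, hwv⟩ := exists_iUnion_eq_closure_subset hvo hvf.point_finite hvc
  have hwf : LocallyFinite w := hvf.subset fun x => subset_closure.trans (hwv x)
  -- shrinking a second time leaves room for `closure (k x)` inside the open set `w x`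
  obtain ⟨k, hkc, hko, hkw⟩ := exists_iUnion_eq_closure_subset hwo hwf.point_finite hwc
  have hcl : ∀ x, IsCompact (closure (w x)) := fun x =>
    (hB x).of_isClosed_subset isClosed_closure
      ((hwv x).trans ((hvB x).trans interior_subset))
  -- only countably many members of the cover are nonempty; number them
  let I := {x // (v x).Nonempty}
  have hvI : LocallyFinite fun i : I => v i := hvf.comp_injective Subtype.val_injective
  have : Countable I := countable_univ_iff.1 (hvI.countable_univ fun i => i.2)
  have := Encodable.ofCountable I
  have hch : ∀ n : ℕ, ∃ (a : M) (K C : Set M), IsCompact K ∧ IsCompact C ∧ K ⊆ interior C ∧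
      C ⊆ S a ∧ (∀ i : I, Encodable.encode i = n → K = closure (k i)) ∧
      ∀ x ∈ C, ∃ i : I, Encodable.encode i = n ∧ x ∈ v i := by
    intro n
    -- numbers that are not used get the empty set
    by_cases hn : ∃ i : I, Encodable.encode i = n
    · obtain ⟨i, rfl⟩ := hn
      refine ⟨i, closure (k i), closure (w i), ?_, hcl i, ?_, ?_, ?_, ?_⟩
      · exact (hcl i).of_isClosed_subset isClosed_closure ((hkw i).trans subset_closure)
      · exact (hkw i).trans ((hwo i).subset_interior_iff.2 subset_closure)
      · exact (hwv i).trans ((hvB i).trans (interior_subset.trans (hBS i)))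
      · intro j hj
        rw [Encodable.encode_injective hj]
      · exact fun x hx => ⟨i, rfl, hwv i hx⟩
    · obtain ⟨x₀⟩ := (inferInstance : Nonempty M)
      exact ⟨x₀, ∅, ∅, isCompact_empty, isCompact_empty, empty_subset _, empty_subset _,
        fun i hi => absurd ⟨i, hi⟩ hn, fun x hx => hx.elim⟩
  choose a K C hK hC hKC hCS hKk hCv using hch
  refine ⟨a, K, C, hK, hC, hKC, hCS, ?_, fun x => ?_⟩
  · refine eq_univ_of_forall fun x => ?_
    obtain ⟨i, hi⟩ := mem_iUnion.1 (hkc ▸ mem_univ x)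
    have hxv : x ∈ v i := hwv i (subset_closure (hkw i (subset_closure hi)))
    refine mem_iUnion.2 ⟨Encodable.encode (⟨i, x, hxv⟩ : I), ?_⟩
    rw [hKk _ ⟨i, x, hxv⟩ rfl]
    exact subset_closure hi
  · obtain ⟨t, ht, hfin⟩ := hvI x
    refine ⟨t, ht, (hfin.image Encodable.encode).subset ?_⟩
    rintro n ⟨y, hyC, hyt⟩
    obtain ⟨i, hi, hyi⟩ := hCv n y hyC
    exact ⟨i, ⟨y, hyi, hyt⟩, hi⟩

end Topology

/-! ### Smoothing in one chart -/

section LocalSmoothing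

/-- A smooth cut-off function `β` that is `1` on an open set `Q₁` containing the compact set `P` and
vanishes outside a closed set `Q₂` contained in the open set `Ω`. -/
theorem exists_contDiff_one_on_nhds {V : Type*} [NormedAddCommGroup V] [NormedSpace ℝ V]
    [FiniteDimensional ℝ V] {P Ω : Set V} (hP : IsCompact P) (hΩ : IsOpen Ω) (h : P ⊆ Ω) :
    ∃ (β : V → ℝ) (Q₁ Q₂ : Set V), ContDiff ℝ ∞ β ∧ (∀ x, β x ∈ Icc (0 : ℝ) 1) ∧ IsOpen Q₁ ∧
      IsClosed Q₂ ∧ P ⊆ Q₁ ∧ Q₁ ⊆ Q₂ ∧ Q₂ ⊆ Ω ∧ (∀ x ∈ Q₁, β x = 1) ∧ ∀ x ∉ Q₂, β x = 0 := by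
  obtain ⟨Q₂, hQ₂, hPQ₂, hQ₂Ω⟩ := exists_compact_between hP hΩ h
  obtain ⟨Q₁, hQ₁, hPQ₁, hQ₁Q₂⟩ := exists_compact_between hP isOpen_interior hPQ₂
  obtain ⟨β, h0, h1, hβ⟩ := exists_contMDiffMap_zero_one_of_isClosed (n := ⊤) 𝓘(ℝ, V)
    isOpen_interior.isClosed_compl hQ₁.isClosed (disjoint_compl_left_iff_subset.2 hQ₁Q₂)
  exact ⟨β, interior Q₁, Q₂, β.contMDiff.contDiff, hβ, isOpen_interior, hQ₂.isClosed, hPQ₁,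
    (interior_subset.trans hQ₁Q₂).trans interior_subset, hQ₂Ω, fun x hx => h1 (interior_subset hx),
    fun x hx => h0 fun hx' => hx (interior_subset hx')⟩

theorem relOpenInConvex_univ {V : Type*} [AddCommGroup V] [Module ℝ V] [TopologicalSpace V] :
    RelOpenInConvex (univ : Set V) :=
  ⟨univ, univ, convex_univ, fat_univ, isOpen_univ, by simp⟩

variable {d : ℕ} {M : Type*} [TopologicalSpace M] [ChartedSpace (EuclideanQuadrant d) M]
  [IsManifold (modelWithCornersEuclideanQuadrant d) ∞ M]

theorem smoothInChart_comp_chart {Z : Type*} [NormedAddCommGroup Z] [NormedSpace ℝ Z]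
    {β : EuclideanSpace ℝ (Fin d) → Z} (hβ : ContDiff ℝ ∞ β)
    {e e' : OpenPartialHomeomorph M (EuclideanQuadrant d)} (he : e ∈ atlas (EuclideanQuadrant d) M)
    (he' : e' ∈ atlas (EuclideanQuadrant d) M) :
    SmoothInChart (quadrantIncl d) e e'.source fun x => β (quadrantIncl d (e' x)) :=
  SmoothInChart.comp (isConvexModel_quadrantIncl d) e'.open_source
    (ContDiffOn.cinftyOn relOpenInConvex_univ hβ.contDiffOn) (smoothInChart_coordChange d he he')
    fun _ _ _ => mem_univ _

omit [ChartedSpace (EuclideanQuadrant d) M]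
  [IsManifold (modelWithCornersEuclideanQuadrant d) ∞ M] in
theorem continuousOn_chart (e : OpenPartialHomeomorph M (EuclideanQuadrant d)) :
    ContinuousOn (fun x => quadrantIncl d (e x)) e.source :=
  (isConvexModel_quadrantIncl d).isEmbedding.continuous.comp_continuousOn e.continuousOn

variable {Y : Type*} [AddCommGroup Y] [Module ℝ Y] [TopologicalSpace Y] [T2Space Y]
  [IsTopologicalAddGroup Y] [ContinuousSMul ℝ Y] [LocallyConvexSpace ℝ Y]

omit [LocallyConvexSpace ℝ Y] in
/-- On a compact set, a continuous map is approximated by the convex combinations of its values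
that a smooth partition of unity provides.  No integration is involved, so that the target need not
be complete. -/
theorem exists_smooth_approx
    {e : OpenPartialHomeomorph M (EuclideanQuadrant d)} (he : e ∈ atlas (EuclideanQuadrant d) M)
    {Z S : Set M} (hZ : IsCompact Z) (hS : IsOpen S) (hZS : Z ⊆ S) (hSe : S ⊆ e.source)
    {f : M → Y} (hf : ContinuousOn f S) {V : Set Y} (hV : V ∈ 𝓝 0) (hVc : Convex ℝ V) :
    ∃ h : M → Y, (∀ e₁ ∈ atlas (EuclideanQuadrant d) M,
        SmoothInChart (quadrantIncl d) e₁ e.source h) ∧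
      ContinuousOn h e.source ∧ ∀ x ∈ Z, h x - f x ∈ V := by
  have hι := isConvexModel_quadrantIncl d
  let G : M → Set M := fun z => S ∩ (fun x => f z - f x) ⁻¹' interior V
  have hG : ∀ z, IsOpen (G z) := fun z =>
    (continuousOn_const.sub hf).isOpen_inter_preimage hS isOpen_interior
  choose Ω hΩ hΩG _ using fun z => exists_chartImage_inter hι e (hG z)
  have hzG : ∀ z ∈ Z, z ∈ G z := fun z hz => ⟨hZS hz, by
    simpa using mem_interior_iff_mem_nhds.2 hV⟩
  obtain ⟨T, hTZ, hT⟩ := hZ.elim_nhds_subcover G fun z hz => (hG z).mem_nhds (hzG z hz)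
  have hcomp : IsCompact ((fun x => quadrantIncl d (e x)) '' Z) :=
    hZ.image_of_continuousOn ((continuousOn_chart e).mono (hZS.trans hSe))
  obtain ⟨ρ, hρ⟩ := SmoothPartitionOfUnity.exists_isSubordinate 𝓘(ℝ, EuclideanSpace ℝ (Fin d))
    hcomp.isClosed (fun z : T => Ω z) (fun z => hΩ z) (by
      rintro _ ⟨x, hx, rfl⟩
      obtain ⟨z, hz, hxz⟩ := mem_iUnion₂.1 (hT hx)
      exact mem_iUnion.2 ⟨⟨z, hz⟩, (hΩG z x (hSe (hZS hx))).2 hxz⟩)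
  have hρs : ∀ z : T, ContDiff ℝ ∞ (ρ z) := fun z => (ρ z).contMDiff.contDiff
  refine ⟨fun x => ∑ z : T, ρ z (quadrantIncl d (e x)) • f z, fun e₁ he₁ n => ?_, ?_, ?_⟩
  · have hfat := (relOpenInConvex_chartImage hι e₁ e.open_source).fat
    have := CkOn.sum hfat (n := n) Finset.univ (f := fun (z : T) x =>
      (ρ z (quadrantIncl d (e (chartInv (quadrantIncl d) e₁ x)))) • f z) fun z _ =>
      CkOn.smul hfat (smoothInChart_comp_chart (hρs z) he₁ he n) (CkOn.const hfat n (f z))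
    exact this
  · exact continuousOn_finsetSum _ fun z _ =>
      ((hρs z).continuous.comp_continuousOn (continuousOn_chart e)).smul continuousOn_const
  · intro x hx
    have hx' : quadrantIncl d (e x) ∈ (fun x => quadrantIncl d (e x)) '' Z := ⟨x, hx, rfl⟩
    have h1 : ∑ z : T, ρ z (quadrantIncl d (e x)) = 1 := by
      rw [← finsum_eq_sum_of_fintype]
      exact ρ.sum_eq_one hx'
    have h2 : ∑ z : T, ρ z (quadrantIncl d (e x)) • f z - f x =
        ∑ z : T, ρ z (quadrantIncl d (e x)) • (f z - f x) := by
      simp only [smul_sub, Finset.sum_sub_distrib, ← Finset.sum_smul, h1, one_smul]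
    rw [h2, ← finsum_eq_sum_of_fintype]
    refine hVc.finsum_mem (fun z => ρ.nonneg z _) (ρ.sum_eq_one hx') fun z hz => ?_
    have h3 : quadrantIncl d (e x) ∈ Ω z := hρ z (subset_tsupport _ hz)
    exact interior_subset ((hΩG z x (hSe (hZS hx))).1 h3).2

variable {N : Type*} [TopologicalSpace N] [ChartedSpace Y N]
  {E : Type*} [TopologicalSpace E] [ChartedSpace (ModelProd (EuclideanQuadrant d) Y) E]
  {π : E → M} {φ : Bundle.Trivialization N π}

/-- Let `F` be a homotopy of sections, with values in an open set `O`, the end of which is smooth on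
`A`.  It can be changed over a compact set `C` in such a way that its end becomes smooth near
`K ∩ L`, too, while the beginning and everything over the complement of `U` are kept.

In fibre coordinates `f`, the new homotopy is `f (t, x) + t θ(x) (h x - f (1, x))`, where `h` is a
smooth approximation of `f (1, ·)` and the smooth function `θ` has support in `C ∩ U` and is equal
to `1` near the compact set `(K ∩ L) \ A`. -/
theorem exists_smoothing_step [T2Space M]
    (hφ : LCManifoldSmoothOn (quadrantProdIncl d Y) (quadrantProdIncl d Y) (φ : E → M × N) φ.source)
    (hφ' : LCManifoldSmoothOn (quadrantProdIncl d Y) (quadrantProdIncl d Y)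
      (φ.toOpenPartialHomeomorph.symm : M × N → E) φ.target)
    {e : OpenPartialHomeomorph M (EuclideanQuadrant d)} (he : e ∈ atlas (EuclideanQuadrant d) M)
    {c : OpenPartialHomeomorph N Y} (hc : c ∈ atlas Y N)
    {K C : Set M} (hK : IsCompact K) (hC : IsCompact C) (hKC : K ⊆ interior C) (hCe : C ⊆ e.source)
    (hCφ : C ⊆ φ.baseSet) {O : Set E} (hO : IsOpen O)
    (hOC : ∀ q ∈ O, π q ∈ C → (φ q).2 ∈ c.source)
    {L U : Set M} (hL : IsClosed L) (hU : IsOpen U)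
    {F : unitInterval × M → E} (hF : Continuous F) (hFO : ∀ p, F p ∈ O) (hFπ : ∀ p, π (F p) = p.2)
    {A : Set M} (hA : IsOpen A) (hLA : L \ U ⊆ A)
    (hFA : LCManifoldSmoothOn (quadrantIncl d) (quadrantProdIncl d Y) (fun x => F (1, x)) A) :
    ∃ (F' : unitInterval × M → E) (A' : Set M), Continuous F' ∧ (∀ p, F' p ∈ O) ∧
      (∀ p, π (F' p) = p.2) ∧ IsOpen A' ∧ A ⊆ A' ∧ K ∩ L ⊆ A' ∧
      LCManifoldSmoothOn (quadrantIncl d) (quadrantProdIncl d Y) (fun x => F' (1, x)) A' ∧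
      (∀ p, p.2 ∉ C → F' p = F p) ∧ (∀ p, p.2 ∉ U → F' p = F p) ∧ ∀ x, F' (0, x) = F (0, x) := by
  classical
  have hι := isConvexModel_quadrantIncl d
  set S := interior C with hSdef
  have hS : IsOpen S := isOpen_interior
  have hSC : S ⊆ C := interior_subset
  have hSe : S ⊆ e.source := hSC.trans hCe
  -- the cut-off function
  have hP : IsCompact ((K ∩ L) \ A) := (hK.inter_right hL).diff hA
  have hPS : (K ∩ L) \ A ⊆ S ∩ U := fun x hx =>
    ⟨hKC hx.1.1, by_contra fun hxU => hx.2 (hLA ⟨hx.1.2, hxU⟩)⟩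
  obtain ⟨Ω, hΩ, hΩS, -⟩ := exists_chartImage_inter hι e (hS.inter hU)
  obtain ⟨β, Q₁, Q₂, hβ, hβI, hQ₁, hQ₂, hPQ₁, hQ₁₂, hQ₂Ω, hβ1, hβ0⟩ :=
    exists_contDiff_one_on_nhds
      (hP.image_of_continuousOn ((continuousOn_chart e).mono
        ((hPS.trans inter_subset_left).trans hSe))) hΩ (by
      rintro _ ⟨x, hx, rfl⟩
      exact (hΩS x (hSe (hPS hx).1)).2 (hPS hx))
  let θ : M → ℝ := fun x => β (quadrantIncl d (e x))
  let Z : Set M := C ∩ (fun x => quadrantIncl d (e x)) ⁻¹' Q₂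
  have hZc : IsClosed Z :=
    ((continuousOn_chart e).mono hCe).preimage_isClosed_of_isClosed hC.isClosed hQ₂
  have hZ : IsCompact Z := hC.of_isClosed_subset hZc inter_subset_left
  have hZSU : Z ⊆ S ∩ U := fun x hx => (hΩS x (hCe hx.1)).1 (hQ₂Ω hx.2)
  have hZS : Z ⊆ S := fun x hx => (hZSU hx).1
  have hθ0 : ∀ x ∈ S, x ∉ Z → θ x = 0 := fun x hxS hxZ => hβ0 _ fun h => hxZ ⟨hSC hxS, h⟩
  have hθc : ContinuousOn θ S := hβ.continuous.comp_continuousOn ((continuousOn_chart e).mono hSe)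
  -- the fibre coordinate of the homotopy
  let f : unitInterval × M → Y := fun p => c (φ (F p)).2
  have hFs : ∀ p : unitInterval × M, p.2 ∈ S → F p ∈ φ.source := fun p hp => by
    rw [φ.mem_source, hFπ]; exact hCφ (hSC hp)
  have hFc : ∀ p : unitInterval × M, p.2 ∈ S → (φ (F p)).2 ∈ c.source := fun p hp =>
    hOC _ (hFO p) (by rw [hFπ]; exact hSC hp)
  have hφF : ContinuousOn (fun p => φ (F p)) (Prod.snd ⁻¹' S) :=
    hφ.1.comp hF.continuousOn hFs
  have hfc : ContinuousOn f (Prod.snd ⁻¹' S) :=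
    c.continuousOn.comp (continuous_snd.comp_continuousOn hφF) hFc
  have hf1 : ContinuousOn (fun x => f (1, x)) S :=
    hfc.comp (f := fun x : M => ((1 : unitInterval), x)) (by fun_prop) fun x hx => hx
  have hft : ∀ p : unitInterval × M, p.2 ∈ S → f p ∈ c.target := fun p hp => c.map_source (hFc p hp)
  -- the point of `E` with fibre coordinate `y` over `x`
  let R : M → Y → E := fun x y => φ.toOpenPartialHomeomorph.symm (x, c.symm y)
  have hRF : ∀ p : unitInterval × M, p.2 ∈ S → R p.2 (f p) = F p := fun p hp => by
    simp only [R, f]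
    rw [c.left_inv (hFc p hp)]
    conv_lhs => rw [← hFπ p]
    exact φ.symm_apply_mk_proj (hFs p hp)
  have hRc : ContinuousOn (fun q : M × Y => R q.1 q.2) (S ×ˢ c.target) := by
    refine hφ'.1.comp (f := fun q : M × Y => (q.1, c.symm q.2))
      (continuousOn_fst.prodMk (c.continuousOn_symm.comp continuousOn_snd fun q hq => hq.2)) ?_
    intro q hq
    exact φ.mem_target.2 (hCφ (hSC hq.1))
  -- fibre coordinates that are close to `f` belong to points of `O`
  have hadd : ContinuousOn (fun q : (unitInterval × M) × Y => f q.1 + q.2)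
      ((Prod.snd ⁻¹' S) ×ˢ univ) :=
    (hfc.comp continuousOn_fst fun q hq => hq.1).add continuousOn_snd
  let D : Set ((unitInterval × M) × Y) :=
    ((Prod.snd ⁻¹' S) ×ˢ univ) ∩ (fun q => f q.1 + q.2) ⁻¹' c.target
  have hD : IsOpen D := hadd.isOpen_inter_preimage
    ((hS.preimage continuous_snd).prod isOpen_univ) c.open_target
  have hDc : ContinuousOn (fun q : (unitInterval × M) × Y => R q.1.2 (f q.1 + q.2)) D :=
    hRc.comp (f := fun q : (unitInterval × M) × Y => (q.1.2, f q.1 + q.2))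
      ((by fun_prop : Continuous fun q : (unitInterval × M) × Y => q.1.2).continuousOn.prodMk
        (hadd.mono inter_subset_left)) fun q hq => ⟨hq.1.1, hq.2⟩
  have hIZ : IsCompact ((univ : Set unitInterval) ×ˢ Z) := isCompact_univ.prod hZ
  obtain ⟨u, v, -, hvo, hu, hv, huv⟩ := generalized_tube_lemma hIZ
    (isCompact_singleton (x := (0 : Y))) (hDc.isOpen_inter_preimage hD hO) (by
      rintro ⟨⟨t, x⟩, y⟩ ⟨⟨-, hx⟩, rfl⟩
      have hx : x ∈ S := hZS hx
      refine ⟨⟨⟨hx, mem_univ _⟩, ?_⟩, ?_⟩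
      · simpa using hft (t, x) hx
      · simpa [hRF (t, x) hx] using hFO (t, x))
  obtain ⟨V, ⟨hV, hVc⟩, hVv⟩ := (LocallyConvexSpace.convex_basis_zero ℝ Y).mem_iff.1
    (hvo.mem_nhds (hv rfl))
  obtain ⟨h, hhs, hhc, hhV⟩ := exists_smooth_approx he hZ hS hZS hSe hf1 hV hVc
  -- the new fibre coordinate
  let g : unitInterval × M → Y := fun p => f p + ((p.1 : ℝ) * θ p.2) • (h p.2 - f (1, p.2))
  have hgf : ∀ p : unitInterval × M, p.2 ∈ S → p.2 ∉ Z → g p = f p := fun p hp hpZ => by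
    simp only [g, hθ0 _ hp hpZ, mul_zero, zero_smul, add_zero]
  have hgD : ∀ p : unitInterval × M, p.2 ∈ Z →
      (p, ((p.1 : ℝ) * θ p.2) • (h p.2 - f (1, p.2))) ∈
        D ∩ (fun q => R q.1.2 (f q.1 + q.2)) ⁻¹' O := fun p hp =>
    huv ⟨hu ⟨mem_univ _, hp⟩, hVv (hVc.smul_mem_of_zero_mem (mem_of_mem_nhds hV) (hhV _ hp)
      ⟨mul_nonneg p.1.2.1 (hβI _).1, mul_le_one₀ p.1.2.2 (hβI _).1 (hβI _).2⟩)⟩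
  have hgt : ∀ p : unitInterval × M, p.2 ∈ S → g p ∈ c.target := fun p hp => by
    by_cases hpZ : p.2 ∈ Z
    · exact (hgD p hpZ).1.2
    · rw [hgf p hp hpZ]; exact hft p hp
  have hgc : ContinuousOn g (Prod.snd ⁻¹' S) := by
    have h1 : ContinuousOn (fun p : unitInterval × M => θ p.2) (Prod.snd ⁻¹' S) :=
      hθc.comp continuousOn_snd fun p hp => hp
    have h2 : ContinuousOn (fun p : unitInterval × M => h p.2) (Prod.snd ⁻¹' S) :=
      (hhc.mono hSe).comp continuousOn_snd fun p hp => hp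
    have h3 : ContinuousOn (fun p : unitInterval × M => f (1, p.2)) (Prod.snd ⁻¹' S) :=
      hf1.comp continuousOn_snd fun p hp => hp
    exact hfc.add (((continuous_subtype_val.comp continuous_fst).continuousOn.mul h1).smul
      (h2.sub h3))
  let F' : unitInterval × M → E := fun p => if p.2 ∈ Z then R p.2 (g p) else F p
  have hF'Z : ∀ p, p.2 ∉ Z → F' p = F p := fun p hp => if_neg hp
  have hF'S : ∀ p : unitInterval × M, p.2 ∈ S → F' p = R p.2 (g p) := fun p hp => by
    by_cases hpZ : p.2 ∈ Z
    · exact if_pos hpZ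
    · rw [hF'Z p hpZ, hgf p hp hpZ, hRF p hp]
  have hF'c : Continuous F' := by
    rw [← continuousOn_univ]
    have hcov : (univ : Set (unitInterval × M)) = Prod.snd ⁻¹' S ∪ Prod.snd ⁻¹' Zᶜ := by
      refine (eq_univ_of_forall fun p => ?_).symm
      by_cases hpZ : p.2 ∈ Z
      · exact Or.inl (hZS hpZ)
      · exact Or.inr hpZ
    rw [hcov]
    refine ContinuousOn.union_of_isOpen ?_ ?_ (hS.preimage continuous_snd)
      (hZc.isOpen_compl.preimage continuous_snd)
    · exact (hRc.comp (f := fun p : unitInterval × M => (p.2, g p)) (continuousOn_snd.prodMk hgc)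
        fun p hp => ⟨hp, hgt p hp⟩).congr hF'S
    · exact hF.continuousOn.congr fun p hp => hF'Z p hp
  -- the end of the new homotopy is smooth where its fibre coordinate is
  have hsmooth : ∀ G ⊆ S, IsOpen G → (∀ e₁ ∈ atlas (EuclideanQuadrant d) M,
      SmoothInChart (quadrantIncl d) e₁ G fun x => g (1, x)) →
      LCManifoldSmoothOn (quadrantIncl d) (quadrantProdIncl d Y) (fun x => F' (1, x)) G := by
    intro G hGS hG hg
    refine (lcManifoldSmoothOn_of_fibreCoord hφ' hG ((hGS.trans hSC).trans hCφ) hc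
      (hgc.comp (f := fun x : M => ((1 : unitInterval), x)) (by fun_prop) fun x hx => hGS hx)
      (fun x hx => hgt (1, x) (hGS hx)) hg).congr hι hG fun x hx => ?_
    exact (hF'S (1, x) (hGS hx)).symm
  let B : Set M := S ∩ (fun x => quadrantIncl d (e x)) ⁻¹' Q₁
  have hB : IsOpen B := ((continuousOn_chart e).mono hSe).isOpen_inter_preimage hS hQ₁
  refine ⟨F', A ∪ B, hF'c, fun p => ?_, fun p => ?_, hA.union hB, subset_union_left, ?_, ?_, ?_, ?_,
    ?_⟩
  · by_cases hpZ : p.2 ∈ Z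
    · rw [hF'S p (hZS hpZ)]
      exact (hgD p hpZ).2
    · rw [hF'Z p hpZ]; exact hFO p
  · by_cases hpZ : p.2 ∈ Z
    · rw [hF'S p (hZS hpZ)]
      exact φ.proj_symm_apply' (hCφ (hSC (hZS hpZ)))
    · rw [hF'Z p hpZ]; exact hFπ p
  · intro x hx
    by_cases hxA : x ∈ A
    · exact Or.inl hxA
    · exact Or.inr ⟨hKC hx.1, hPQ₁ ⟨x, ⟨hx, hxA⟩, rfl⟩⟩
  · refine LCManifoldSmoothOn.of_locally hι (hA.union hB) fun p hp => ?_
    by_cases hpB : p ∈ B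
    · -- here `θ = 1`, so that the new fibre coordinate is the smooth map `h`
      refine ⟨B, hB, hpB, hsmooth B inter_subset_left hB fun e₁ he₁ => ?_⟩
      refine ((hhs e₁ he₁).mono hι hB (inter_subset_left.trans hSe)).congr hι fun x hx _ => ?_
      have : θ x = 1 := hβ1 _ hx.2
      simp [g, this]
    have hpA : p ∈ A := hp.resolve_right hpB
    by_cases hpZ : p ∈ Z
    · -- here all of `f`, `θ` and `h` are smooth
      have hG := hA.inter hS
      refine ⟨A ∩ S, hG, ⟨hpA, hZS hpZ⟩, hsmooth _ inter_subset_right hG fun e₁ he₁ n => ?_⟩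
      have hfat := (relOpenInConvex_chartImage hι e₁ hG).fat
      have h1 := smoothInChart_fibreCoord hφ hG (hFA.mono hι hA hG inter_subset_left) hc
        (fun x hx => ⟨hFπ _, hFs (1, x) hx.2, hFc (1, x) hx.2⟩) he₁
      have h2 := (smoothInChart_comp_chart hβ he₁ he).mono hι hG (inter_subset_right.trans hSe)
      have h3 := (hhs e₁ he₁).mono hι hG (inter_subset_right.trans hSe)
      have h4 := (h1 n).add hfat ((h2 n).smul hfat ((h3 n).sub hfat (h1 n)))
      refine h4.congr fun x hx => ?_
      simp [g, f, θ]
    · have hG := hA.inter hZc.isOpen_compl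
      refine ⟨A ∩ Zᶜ, hG, ⟨hpA, hpZ⟩, (hFA.mono hι hA hG inter_subset_left).congr hι hG
        fun x hx => (hF'Z (1, x) hx.2).symm⟩
  · exact fun p hp => hF'Z p fun hpZ => hp hpZ.1
  · exact fun p hp => hF'Z p fun hpZ => hp (hZSU hpZ).2
  · intro x
    by_cases hx : x ∈ Z
    · rw [hF'S (0, x) (hZS hx), show g (0, x) = f (0, x) by simp [g], hRF (0, x) (hZS hx)]
    · exact hF'Z (0, x) hx

end LocalSmoothing

/-! ### The approximation theorem -/

/-- A topological group on which a nonempty Hausdorff space is modelled is itself Hausdorff, since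
it has a nonempty open subset that is Hausdorff. -/
theorem t2Space_of_chartedSpace_t2 {Y : Type*} [AddCommGroup Y] [TopologicalSpace Y]
    [IsTopologicalAddGroup Y] {N : Type*} [TopologicalSpace N] [T2Space N] [ChartedSpace Y N]
    (n : N) : T2Space Y := by
  refine IsTopologicalAddGroup.t2Space_of_zero_sep fun x hx => ?_
  by_contra! hU
  let c := chartAt Y n
  have hn : n ∈ c.source := mem_chart_source Y n
  -- translation by `c n` makes `c n + x` belong to all neighbourhoods of `c n`
  have hall : ∀ V ∈ 𝓝 (c n), c n + x ∈ V := fun V hV =>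
    hU ((fun y => c n + y) ⁻¹' V) ((continuous_const_add (c n)).continuousAt.preimage_mem_nhds
      (by simpa using hV))
  have ht := hall _ (c.open_target.mem_nhds (c.map_source hn))
  have hne : n ≠ c.symm (c n + x) := fun h => hx <| by
    have := c.right_inv ht
    rw [← h] at this
    simpa using this
  have hV : c.symm ⁻¹' {c.symm (c n + x)}ᶜ ∈ 𝓝 (c n) := by
    refine (c.continuousAt_symm (c.map_source hn)).preimage_mem_nhds ?_
    rw [c.left_inv hn]
    exact isOpen_compl_singleton.mem_nhds hne
  exact hall _ hV rfl

theorem mainTheorem1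
    -- the base: a finite-dimensional connected manifold with corners
    (d : ℕ) {M : Type*} [TopologicalSpace M] [ChartedSpace (EuclideanQuadrant d) M]
    [IsManifold (modelWithCornersEuclideanQuadrant d) ∞ M]
    [T2Space M] [ParacompactSpace M] [ConnectedSpace M]
    -- the typical fibre: a manifold modelled on a locally convex space
    {Y : Type*} [AddCommGroup Y] [Module ℝ Y] [TopologicalSpace Y]
    [IsTopologicalAddGroup Y] [ContinuousSMul ℝ Y] [LocallyConvexSpace ℝ Y]
    {N : Type*} [TopologicalSpace N] [ChartedSpace Y N] [T2Space N]
    (hN : IsLCManifold (id : Y → Y) N)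
    -- the total space and the bundle projection
    {E : Type*} [TopologicalSpace E] [ChartedSpace (ModelProd (EuclideanQuadrant d) Y) E]
    [T2Space E] (hE : IsLCManifold (quadrantProdIncl d Y) E)
    (π : E → M) (hπ : IsLocallyTrivialSmoothBundle d Y N π)
    -- a continuous section that is smooth on a neighbourhood of `L \ U`
    (σ : M → E) (hσ : Continuous σ) (hσπ : ∀ x, π (σ x) = x)
    (L U : Set M) (hL : IsClosed L) (hU : IsOpen U)
    (hσL : ∃ A : Set M, IsOpen A ∧ L \ U ⊆ A ∧
      LCManifoldSmoothOn (quadrantIncl d) (quadrantProdIncl d Y) σ A)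
    -- an open neighbourhood of `σ(M)`
    (O : Set E) (hO : IsOpen O) (hσO : range σ ⊆ O) :
    ∃ τ : M → E,
      Continuous τ ∧ (∀ x, π (τ x) = x) ∧ (∀ x, τ x ∈ O) ∧
      (∃ B : Set M, IsOpen B ∧ L ⊆ B ∧
        LCManifoldSmoothOn (quadrantIncl d) (quadrantProdIncl d Y) τ B) ∧
      (∀ x, x ∉ U → τ x = σ x) ∧
      ∃ F : unitInterval × M → E,
        Continuous F ∧ (∀ t x, F (t, x) ∈ O) ∧ (∀ t x, π (F (t, x)) = x) ∧
        (∀ x, F (0, x) = σ x) ∧ (∀ x, F (1, x) = τ x) ∧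
        (∀ t x, x ∉ U → F (t, x) = σ x ∧ F (t, x) = τ x) := by
  have hι := isConvexModel_quadrantIncl d
  choose φ hφb hφ hφ' using hπ
  obtain ⟨x₀⟩ := (inferInstance : Nonempty M)
  have : T2Space Y := t2Space_of_chartedSpace_t2 (φ x₀ (σ x₀)).2
  have hπc : Continuous π := continuous_iff_continuousAt.2 fun q =>
    (φ (π q)).continuousAt_proj ((φ (π q)).mem_source.2 (hφb (π q)))
  -- the open sets over which `σ` takes values in a chart of the fibre
  let e : M → OpenPartialHomeomorph M (EuclideanQuadrant d) := fun x => chartAt _ x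
  let c : M → OpenPartialHomeomorph N Y := fun x => chartAt Y (φ x (σ x)).2
  let D : M → Set E := fun x => (φ x).source ∩ (fun q => (φ x q).2) ⁻¹' (c x).source
  have hD : ∀ x, IsOpen (D x) := fun x =>
    (continuous_snd.comp_continuousOn (hφ x).1).isOpen_inter_preimage (φ x).open_source
      (c x).open_source
  have hS : ∀ x, (e x).source ∩ σ ⁻¹' D x ∈ 𝓝 x := fun x =>
    ((e x).open_source.inter ((hD x).preimage hσ)).mem_nhds
      ⟨mem_chart_source _ x, (φ x).mem_source.2 (by rw [hσπ]; exact hφb x), mem_chart_source Y _⟩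
  have : LocallyCompactSpace M :=
    Manifold.locallyCompact_of_finiteDimensional (modelWithCornersEuclideanQuadrant d)
  obtain ⟨a, K, C, hK, hC, hKC, hCS, hKcov, hCf⟩ := exists_locallyFinite_compact_cover hS
  -- sections with values in `O'` take values in the same charts of the fibre as `σ`
  let T : ℕ → Set E := fun n => π ⁻¹' C n \ D (a n)
  have hT : IsClosed (⋃ n, T n) :=
    ((hCf.preimage_continuous hπc).subset fun n => sdiff_subset).isClosed_iUnion fun n =>
      ((hC n).isClosed.preimage hπc).sdiff (hD (a n))
  let O' : Set E := O \ ⋃ n, T n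
  have hO' : IsOpen O' := hO.sdiff hT
  have hO'C : ∀ n, ∀ q ∈ O', π q ∈ C n → q ∈ D (a n) := fun n q hq hqC => by
    by_contra hqD
    exact hq.2 (mem_iUnion.2 ⟨n, hqC, hqD⟩)
  have hσO' : ∀ x, σ x ∈ O' := fun x => ⟨hσO (mem_range_self x), fun h => by
    obtain ⟨n, hn, hnD⟩ := mem_iUnion.1 h
    have hn : π (σ x) ∈ C n := hn
    rw [hσπ] at hn
    exact hnD (hCS n hn).2⟩
  obtain ⟨A₀, hA₀, hLA₀, hσA₀⟩ := hσL
  -- the homotopies `F`, with ends smooth on `A`, among which the modifications take place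
  let St := {s : (unitInterval × M → E) × Set M // Continuous s.1 ∧ (∀ p, s.1 p ∈ O') ∧
    (∀ p, π (s.1 p) = p.2) ∧ IsOpen s.2 ∧ L \ U ⊆ s.2 ∧
    LCManifoldSmoothOn (quadrantIncl d) (quadrantProdIncl d Y) (fun x => s.1 (1, x)) s.2 ∧
    (∀ p, p.2 ∉ U → s.1 p = σ p.2) ∧ ∀ x, s.1 (0, x) = σ x}
  have hstep : ∀ (n : ℕ) (s : St), ∃ s' : St, s.1.2 ⊆ s'.1.2 ∧ K n ∩ L ⊆ s'.1.2 ∧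
      ∀ p, p.2 ∉ C n → s'.1.1 p = s.1.1 p := by
    rintro n ⟨⟨F, A⟩, hF, hFO, hFπ, hA, hLA, hFA, hFU, hF0⟩
    obtain ⟨F', A', h1, h2, h3, h4, h5, h6, h7, h8, h9, h10⟩ :=
      exists_smoothing_step (hφ (a n)) (hφ' (a n)) (chart_mem_atlas _ (a n))
        (chart_mem_atlas Y (φ (a n) (σ (a n))).2) (hK n) (hC n) (hKC n)
        (fun x hx => (hCS n hx).1) (fun x hx => by
          have := (φ (a n)).mem_source.1 (hCS n hx).2.1
          rwa [hσπ] at this) hO' (fun q hq hqC => (hO'C n q hq hqC).2) hL hU hF hFO hFπ hA hLA hFA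
    exact ⟨⟨⟨F', A'⟩, h1, h2, h3, h4, hLA.trans h5, h7, fun p hp => (h9 p hp).trans (hFU p hp),
      fun x => (h10 x).trans (hF0 x)⟩, h5, h6, h8⟩
  choose step hstepA hstepK hstepC using hstep
  let s : ℕ → St := fun n => Nat.rec ⟨⟨fun p => σ p.2, A₀⟩, hσ.comp continuous_snd,
    fun p => hσO' p.2, fun p => hσπ p.2, hA₀, hLA₀, hσA₀, fun _ _ => rfl, fun _ => rfl⟩ step n
  have hs : ∀ n, s (n + 1) = step n (s n) := fun n => rfl
  have hmono : Monotone fun n => (s n).1.2 := monotone_nat_of_le_succ fun n => by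
    rw [hs]; exact hstepA n (s n)
  -- near each point the sequence of homotopies is eventually constant
  obtain ⟨G, hG⟩ := LocallyFinite.exists_forall_eventually_atTop_eventuallyEq
    (f := fun n (x : M) (t : unitInterval) => (s n).1.1 (t, x))
    (hCf.subset fun n x hx => by
      by_contra hxC
      exact hx (funext fun t => by rw [hs]; exact hstepC n (s n) (t, x) hxC))
  have hGx : ∀ x, ∃ n, ∀ t, (s n).1.1 (t, x) = G x t := fun x => by
    obtain ⟨n, hn⟩ := (hG x).exists
    exact ⟨n, fun t => congrFun hn.self_of_nhds t⟩
  have hGO : ∀ t x, G x t ∈ O := fun t x => by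
    obtain ⟨n, hn⟩ := hGx x
    rw [← hn]; exact ((s n).2.2.1 _).1
  have hGπ : ∀ t x, π (G x t) = x := fun t x => by
    obtain ⟨n, hn⟩ := hGx x
    rw [← hn]; exact (s n).2.2.2.1 _
  have hGU : ∀ t x, x ∉ U → G x t = σ x := fun t x hx => by
    obtain ⟨n, hn⟩ := hGx x
    rw [← hn]; exact (s n).2.2.2.2.2.2.2.1 (t, x) hx
  have hG0 : ∀ x, G x 0 = σ x := fun x => by
    obtain ⟨n, hn⟩ := hGx x
    rw [← hn]; exact (s n).2.2.2.2.2.2.2.2 x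
  have hGc : Continuous fun p : unitInterval × M => G p.2 p.1 :=
    continuous_iff_continuousAt.2 fun p => by
      obtain ⟨n, hn⟩ := (hG p.2).exists
      refine (s n).2.1.continuousAt.congr ?_
      filter_upwards [continuous_snd.continuousAt.eventually hn] with q hq
      exact congrFun hq q.1
  have hopen : ∀ n, IsOpen (s n).1.2 := fun n => (s n).2.2.2.2.1
  refine ⟨fun x => G x 1, hGc.comp (continuous_const.prodMk continuous_id), hGπ 1, hGO 1,
    ⟨⋃ n, (s n).1.2, isOpen_iUnion hopen, fun x hx => ?_, ?_⟩, hGU 1, fun p => G p.2 p.1, hGc,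
    hGO, hGπ, hG0, fun x => rfl, fun t x hx => ⟨hGU t x hx, (hGU t x hx).trans (hGU 1 x hx).symm⟩⟩
  · obtain ⟨n, hn⟩ := mem_iUnion.1 (hKcov ▸ mem_univ x)
    exact mem_iUnion.2 ⟨n + 1, by rw [hs]; exact hstepK n (s n) ⟨hn, hx⟩⟩
  · refine LCManifoldSmoothOn.of_locally hι (isOpen_iUnion hopen) fun x hx => ?_
    obtain ⟨m, hm⟩ := mem_iUnion.1 hx
    obtain ⟨n, hn, hmn⟩ := ((hG x).and (Filter.eventually_ge_atTop m)).exists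
    obtain ⟨W, hWn, hW, hxW⟩ := mem_nhds_iff.1 hn
    have hO := (hopen n).inter hW
    refine ⟨_, hO, ⟨hmono hmn hm, hxW⟩, ((s n).2.2.2.2.2.2.1.mono hι (hopen n) hO
      inter_subset_left).congr hι hO fun y hy => congrFun (hWn hy.2) 1⟩
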